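/- Let $\Theta\subseteq(0,\infty)$ have non-empty interior. For $\vartheta\in\Theta$ let $X_t=\sum_{i=1}^{N_t}\varepsilon_i$, $t\ge 0$, where $(N_t)$ is a homogeneous Poisson process with intensity $\vartheta$ and the $\varepsilon_i$ are i.i.d. with $P(\varepsilon_i=1)=P(\varepsilon_i=-1)=\tfrac12$, independent of $(N_t)$. For $0<\Delta_T\le T$ let $\mathbb P_\vartheta^{T,\Delta_T}$ be the law on $\mathbb Z^{\lfloor T/\Delta_T\rfloor}$ of $\boldsymbol X=(X_{\Delta_T},X_{2\Delta_T},\dots,X_{\lfloor T/\Delta_T\rfloor\Delta_T})$, and let $\mathcal E^{T,\Delta_T}=\{\mathbb P_\vartheta^{T,\Delta_T},\ \vartheta\in\Theta\}$. For a normalisation $I_T>0$, the family $(\mathcal E^{T,\Delta_T})_{T>0}$ is called LAN at $\vartheta\in\Theta$ with information $I_T$ if there are statistics $\xi_T=\xi_T(\boldsymbol X)$, not depending on $v$, with $\xi_T\to\mathcal N(0,1)$ in distribution under $\mathbb P_\vartheta^{T,\Delta_T}$ as $T\to\infty$, such that for every $v\in\mathbb R$ and all $T>0$ with $\vartheta+vI_T^{-1/2}\in\Theta$,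 $$\frac{d\mathbb P^{T,\Delta_T}_{\vartheta+vI_T^{-1/2}}}{d\mathbb P^{T,\Delta_T}_{\vartheta}}(\boldsymbol X)=\exp\Big(v\,\xi_T-\tfrac12v^2+r_T\Big)\qquad \mathbb P_\vartheta^{T,\Delta_T}\text{-almost surely},$$ where $r_T=r_T(v)\to0$ in probability under $\mathbb P_\vartheta^{T,\Delta_T}$ as $T\to\infty$ along these $T$. Theorem (the macroscopic case). Assume that, as $T\to\infty$, $\Delta_T\to\infty$, $T/\Delta_T\to\infty$ and $T/\Delta_T^{1+\frac14}=o\big((\log(T/\Delta_T))^{-\frac14}\big)$. Then at every $\vartheta\in\Theta$ the family $(\mathcal E^{T,\Delta_T})_{T>0}$ is LAN with information $$I_{T,\infty}(\vartheta)=\frac{T\Delta_T^{-1}}{2\vartheta^2},$$ and it is also LAN at $\vartheta$ with any information $I_T>0$ such that $I_T/I_{T,\infty}(\vartheta)\to1$ as $T\to\infty$. -/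

import Mathlib

open MeasureTheory ProbabilityTheory Filter Topology Asymptotics
open scoped NNReal ENNReal BoundedContinuousFunction

noncomputable section

/-- `N` is a homogeneous Poisson process with intensity `ϑ` on the probability space `(Ω, P)`:
it starts at `0`, its paths are nondecreasing and right-continuous, its increments over disjoint
intervals are independent, and `N t - N s` is Poisson distributed with parameter `ϑ (t - s)`.
(The subtraction in `ℕ` is not truncated almost surely, as the paths are nondecreasing.) -/
structure IsPoissonProcess {Ω : Type*} [MeasurableSpace Ω] (ϑ : ℝ) (N : ℝ≥0 → Ω → ℕ)
    (P : Measure Ω) : Prop where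
  measurable : ∀ t, Measurable (N t)
  start_zero : ∀ᵐ ω ∂P, N 0 ω = 0
  monotone_path : ∀ᵐ ω ∂P, Monotone fun t => N t ω
  rightContinuous_path : ∀ᵐ ω ∂P, ∀ t, ContinuousWithinAt (fun s => N s ω) (Set.Ici t) t
  indep_increments : HasIndepIncrements N P
  increment_law : ∀ s t : ℝ≥0, s ≤ t →
    P.map (fun ω => N t ω - N s ω) = poissonMeasure (ϑ.toNNReal * (t - s))

/-- `ε 0, ε 1, …` are independent symmetric Bernoulli variables with values in `{-1, 1}`. -/
structure IsSymmetricBernoulliSequence {Ω : Type*} [MeasurableSpace Ω] (ε : ℕ → Ω → ℤ)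
    (P : Measure Ω) : Prop where
  measurable : ∀ i, Measurable (ε i)
  prob_one : ∀ i, P {ω | ε i ω = 1} = 1 / 2
  prob_neg_one : ∀ i, P {ω | ε i ω = -1} = 1 / 2
  indep : iIndepFun ε P

/-- `X` is a compound Poisson process with intensity `ϑ` and symmetric Bernoulli jumps, started
at `0`: `X_t` is the sum of the first `N_t` terms of a symmetric Bernoulli sequence `ε`, where `N`
is a Poisson process with intensity `ϑ` and the process `N` is independent of the sequence `ε`. -/
def IsBernoulliCompoundPoisson {Ω : Type*} [MeasurableSpace Ω] (ϑ : ℝ) (X : ℝ≥0 → Ω → ℤ)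
    (P : Measure Ω) : Prop :=
  ∃ (N : ℝ≥0 → Ω → ℕ) (ε : ℕ → Ω → ℤ),
    IsPoissonProcess ϑ N P ∧ IsSymmetricBernoulliSequence ε P ∧
    IndepFun (fun ω t => N t ω) (fun ω i => ε i ω) P ∧
    ∀ t ω, X t ω = ∑ i ∈ Finset.range (N t ω), ε i ω

/-- The law of the discrete observation `(X_Δ, X_{2Δ}, …, X_{nΔ})`, with `n = ⌊T / Δ⌋`. -/
def observationLaw {Ω : Type*} [MeasurableSpace Ω] (P : Measure Ω) (X : ℝ≥0 → Ω → ℤ)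
    (T Δ : ℝ) : Measure (Fin ⌊T / Δ⌋₊ → ℤ) :=
  P.map fun ω i => X (((i : ℝ) + 1) * Δ).toNNReal ω

/-- Local asymptotic normality, as `T → ∞`, at the point `ϑ` and with normalisation (information)
`I T`, of the statistical experiments `{Q T ϑ', ϑ' ∈ Θ}`, `T > 0`, on the sample spaces `𝒳 T`.
There is a central sequence `ξ`, which does not depend on the local parameter `v`, that converges
in distribution to `N(0,1)` under `Q T ϑ`. For every `v`, at all those `T` for which the local
alternative `ϑ + v / √(I T)` belongs to `Θ`, the likelihood ratio is `exp (v ξ - v² / 2 + r)`, and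
the remainder `r` tends to `0` in probability under `Q T ϑ` along these `T`. -/
def IsLANAt {𝒳 : ℝ → Type*} [∀ T, MeasurableSpace (𝒳 T)] (Q : ∀ T, ℝ → Measure (𝒳 T))
    (Θ : Set ℝ) (I : ℝ → ℝ) (ϑ : ℝ) : Prop :=
  (∀ T > 0, 0 < I T) ∧
  ∃ ξ : ∀ T, 𝒳 T → ℝ, (∀ T, Measurable (ξ T)) ∧
    (∀ g : ℝ →ᵇ ℝ, Tendsto (fun T => ∫ x, g (ξ T x) ∂(Q T ϑ)) atTop
      (𝓝 (∫ y, g y ∂(gaussianReal 0 1)))) ∧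
    ∀ v : ℝ, ∃ r : ∀ T, 𝒳 T → ℝ, (∀ T, Measurable (r T)) ∧
      (∀ T > 0, ϑ + v / √(I T) ∈ Θ →
        ∀ᵐ x ∂(Q T ϑ), ((Q T (ϑ + v / √(I T))).rnDeriv (Q T ϑ) x).toReal
          = Real.exp (v * ξ T x - v ^ 2 / 2 + r T x)) ∧
      ∀ δ > 0, Tendsto (fun T => Q T ϑ {x | δ < |r T x|})
        (atTop ⊓ 𝓟 {T | ϑ + v / √(I T) ∈ Θ}) (𝓝 0)

/-- The macroscopic information `T Δ_T⁻¹ / (2 ϑ²)`. -/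
def macroInformation (Δ : ℝ → ℝ) (ϑ T : ℝ) : ℝ := T * (Δ T)⁻¹ / (2 * ϑ ^ 2)

end

/-
The increments of the observed path are independent with the symmetric Skellam law of parameter
`l = ϑ Δ`, and `l → ∞`. Under this law the standardised squares `ζ = (y² / l - 1) / √2` are centred,
with variance tending to `1` and bounded fourth moment, so the central limit theorem for triangular
arrays makes `ξ = n^(-1/2) ∑ ζ` asymptotically normal.

A local alternative shifts the mean of `ζ` by `v / √n` to first order, and by the Cauchy-Schwarz
inequality this forces `n` times the squared Hellinger distance to be at least `v² / 4` in the
limit. The Fisher information of the Skellam law is at most `(1 / 2 + O(1 / l)) / l²`, so that the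
same quantity is at most `v² / 4` in the limit. Equality in the Cauchy-Schwarz inequality means that
the square root of the density ratio is `1 + v ζ / (2 √n)` up to `o(1 / √n)` in mean square, from
which the expansion of the log-likelihood follows as usual.

The bound on the Fisher information comes from Stein's identity: applied twice, it expresses the
score as `(y² / l - 1) / (2 l + 1)` minus a multiple of the second-order score, which is small
because the increment is the sum of two independent increments over half of the time span.
-/

section ConvergenceInProbability

variable {ι : Type*} {F : Filter ι} {Ω : ι → Type*} [∀ i, MeasurableSpace (Ω i)]
  {P : ∀ i, Measure (Ω i)} {f g h : ∀ i, Ω i → ℝ}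

/-- Convergence to `0` in probability, along the filter `F`, of a family of random variables `f i`
that may live on different probability spaces `(Ω i, P i)`. -/
def TendstoZeroInProb (P : ∀ i, Measure (Ω i)) (F : Filter ι) (f : ∀ i, Ω i → ℝ) : Prop :=
  ∀ δ > 0, Tendsto (fun i => P i {x | δ < |f i x|}) F (𝓝 0)

lemma tendsto_measure_zero_of_subset_union {A B C : ∀ i, Set (Ω i)}
    (hB : Tendsto (fun i => P i (B i)) F (𝓝 0)) (hC : Tendsto (fun i => P i (C i)) F (𝓝 0))
    (h : ∀ᶠ i in F, A i ⊆ B i ∪ C i) : Tendsto (fun i => P i (A i)) F (𝓝 0) := by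
  refine tendsto_of_tendsto_of_tendsto_of_le_of_le' tendsto_const_nhds
    (by simpa using hB.add hC) (Eventually.of_forall fun _ => zero_le) ?_
  filter_upwards [h] with i hi
  exact (measure_mono hi).trans (measure_union_le _ _)

namespace TendstoZeroInProb

lemma of_tendsto {c : ι → ℝ} (hc : Tendsto c F (𝓝 0)) :
    TendstoZeroInProb P F fun i _ => c i := by
  intro δ hδ
  refine tendsto_const_nhds.congr' ?_
  filter_upwards [(by simpa using hc.abs : Tendsto (fun i => |c i|) F (𝓝 0)).eventually_lt_const hδ]
    with i hi
  simp [hi.not_gt]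

lemma of_abs_le_imp (hf : TendstoZeroInProb P F f) (hg : TendstoZeroInProb P F g)
    (hh : ∀ᶠ i in F, ∀ x, |f i x| ≤ 1 / 2 → |h i x| ≤ |g i x|) : TendstoZeroInProb P F h := by
  intro δ hδ
  refine tendsto_measure_zero_of_subset_union (hf (1 / 2) one_half_pos) (hg δ hδ) ?_
  filter_upwards [hh] with i hi x hx
  rcases lt_or_ge (1 / 2) |f i x| with h1 | h1
  · exact Or.inl h1
  · exact Or.inr (lt_of_lt_of_le hx (hi x h1))

lemma mono (hg : TendstoZeroInProb P F g) (h : ∀ᶠ i in F, ∀ x, |f i x| ≤ |g i x|) :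
    TendstoZeroInProb P F f :=
  (of_tendsto tendsto_const_nhds).of_abs_le_imp hg (h.mono fun _ hi x _ => hi x)

lemma add (hf : TendstoZeroInProb P F f) (hg : TendstoZeroInProb P F g) :
    TendstoZeroInProb P F fun i x => f i x + g i x := by
  intro δ hδ
  refine tendsto_measure_zero_of_subset_union (hf (δ / 2) (half_pos hδ)) (hg (δ / 2) (half_pos hδ))
    (Eventually.of_forall fun i x hx => ?_)
  by_contra! hcon
  simp only [Set.mem_union, Set.mem_ofPred_eq, not_or, not_lt] at hcon hx
  linarith [abs_add_le (f i x) (g i x)]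

lemma const_mul (c : ℝ) (hf : TendstoZeroInProb P F f) :
    TendstoZeroInProb P F fun i x => c * f i x := by
  intro δ hδ
  have hc : 0 < |c| + 1 := by positivity
  refine tendsto_of_tendsto_of_tendsto_of_le_of_le tendsto_const_nhds (hf (δ / (|c| + 1))
    (by positivity)) (fun _ => zero_le) fun i => measure_mono fun x hx => ?_
  simp only [Set.mem_ofPred_eq, abs_mul, div_lt_iff₀ hc] at hx ⊢
  nlinarith [abs_nonneg (f i x)]

lemma sub (hf : TendstoZeroInProb P F f) (hg : TendstoZeroInProb P F g) :
    TendstoZeroInProb P F fun i x => f i x - g i x :=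
  (hf.add (hg.const_mul (-1))).mono (Eventually.of_forall fun i x => by ring_nf; rfl)

lemma mul_of_sub_const {c : ℝ} (hf : TendstoZeroInProb P F f)
    (hg : TendstoZeroInProb P F fun i x => g i x - c) :
    TendstoZeroInProb P F fun i x => f i x * g i x := by
  refine hg.of_abs_le_imp (hf.const_mul (|c| + 1)) (Eventually.of_forall fun i x hx => ?_)
  have hgx : |g i x| ≤ |c| + 1 := by linarith [abs_sub_abs_le_abs_sub (g i x) c]
  rw [abs_mul, abs_mul, abs_of_nonneg (by positivity : 0 ≤ |c| + 1), mul_comm]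
  gcongr

lemma of_pow {m : ℕ} (hf : TendstoZeroInProb P F fun i x => f i x ^ m) :
    TendstoZeroInProb P F f := by
  intro δ hδ
  refine tendsto_of_tendsto_of_tendsto_of_le_of_le tendsto_const_nhds (hf (δ ^ m / 2)
    (by positivity)) (fun _ => zero_le) fun i => measure_mono fun x hx => ?_
  simp only [Set.mem_ofPred_eq, abs_pow] at hx ⊢
  exact (half_lt_self (pow_pos hδ m)).trans_le (pow_le_pow_left₀ hδ.le hx.le m)

lemma of_integral_abs [∀ i, IsFiniteMeasure (P i)] (hf : ∀ᶠ i in F, Integrable (f i) (P i))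
    (h : Tendsto (fun i => ∫ x, |f i x| ∂P i) F (𝓝 0)) : TendstoZeroInProb P F f := by
  intro δ hδ
  have hreal : Tendsto (fun i => (P i).real {x | δ < |f i x|}) F (𝓝 0) := by
    refine squeeze_zero' (Eventually.of_forall fun _ => measureReal_nonneg) ?_
      (by simpa using h.const_mul δ⁻¹)
    filter_upwards [hf] with i hfi
    rw [← div_eq_inv_mul, le_div_iff₀' hδ]
    refine le_trans ?_ (mul_meas_ge_le_integral_of_nonneg
      (Eventually.of_forall fun x => abs_nonneg (f i x)) hfi.abs δ)
    exact mul_le_mul_of_nonneg_left (measureReal_mono fun x (hx : δ < |f i x|) => hx.le) hδ.le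
  have := ENNReal.tendsto_ofReal hreal
  simpa [ofReal_measureReal] using this

end TendstoZeroInProb

end ConvergenceInProbability

section ProductSums

variable {ι : Type*} {F : Filter ι} {𝒴 : Type*} [MeasurableSpace 𝒴]
  {n : ι → ℕ} {μ : ι → Measure 𝒴} [∀ i, IsProbabilityMeasure (μ i)] {f : ι → 𝒴 → ℝ}

lemma integrable_comp_eval_pi {κ : Type*} [Fintype κ] {ν : Measure 𝒴} [IsProbabilityMeasure ν]
    {f : 𝒴 → ℝ} (hf : Integrable f ν) (j : κ) :
    Integrable (fun y : κ → 𝒴 => f (y j)) (Measure.pi fun _ => ν) :=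
  (measurePreserving_eval (fun _ : κ => ν) j).integrable_comp_of_integrable hf

lemma integral_sum_comp_eval_pi {κ : Type*} [Fintype κ] {ν : Measure 𝒴} [IsProbabilityMeasure ν]
    {f : 𝒴 → ℝ} (hf : Integrable f ν) :
    ∫ y : κ → 𝒴, ∑ j, f (y j) ∂(Measure.pi fun _ => ν) = Fintype.card κ * ∫ y, f y ∂ν := by
  rw [integral_finsetSum _ fun j _ => integrable_comp_eval_pi hf j]
  simp [integral_comp_eval (μ := fun _ : κ => ν) hf.aestronglyMeasurable]

lemma tendstoZeroInProb_sum_of_integral_abs (hf : ∀ᶠ i in F, Integrable (f i) (μ i))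
    (h : Tendsto (fun i => n i * ∫ y, |f i y| ∂μ i) F (𝓝 0)) :
    TendstoZeroInProb (fun i => Measure.pi fun _ : Fin (n i) => μ i) F
      fun i y => ∑ j, f i (y j) := by
  have h_int {i : ι} (hfi : Integrable (f i) (μ i)) :
      Integrable (fun y : Fin (n i) → 𝒴 => ∑ j, f i (y j)) (Measure.pi fun _ => μ i) :=
    integrable_finsetSum _ fun j _ => integrable_comp_eval_pi hfi j
  refine TendstoZeroInProb.of_integral_abs (hf.mono fun i => h_int) (squeeze_zero'
    (Eventually.of_forall fun _ => integral_nonneg fun _ => abs_nonneg _) ?_ h)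
  filter_upwards [hf] with i hfi
  have hsum := integral_sum_comp_eval_pi (κ := Fin (n i)) hfi.abs
  rw [Fintype.card_fin] at hsum
  rw [← hsum]
  exact integral_mono (h_int hfi).abs
    (integrable_finsetSum _ fun j _ => integrable_comp_eval_pi hfi.abs j)
    fun y => Finset.abs_sum_le_sum_abs _ _

lemma variance_sum_comp_eval_pi_le {κ : Type*} [Fintype κ] {ν : Measure 𝒴}
    [IsProbabilityMeasure ν] {f : 𝒴 → ℝ} (hf : MemLp f 2 ν) :
    variance (fun y : κ → 𝒴 => ∑ j, f (y j)) (Measure.pi fun _ => ν)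
      ≤ Fintype.card κ * ∫ y, f y ^ 2 ∂ν := by
  have hvar := variance_sum_pi (μ := fun _ : κ => ν) (X := fun _ => f) fun _ => hf
  rw [Finset.sum_const, Finset.card_univ, nsmul_eq_mul] at hvar
  have hfun : (fun y : κ → 𝒴 => ∑ j, f (y j)) = ∑ j, fun y : κ → 𝒴 => f (y j) := by
    ext y; rw [Finset.sum_apply]
  rw [hfun, hvar]
  gcongr
  exact variance_le_expectation_sq hf.aestronglyMeasurable

lemma tendstoZeroInProb_sum_sub_of_integral_sq (hf : ∀ᶠ i in F, MemLp (f i) 2 (μ i))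
    (h : Tendsto (fun i => n i * ∫ y, f i y ^ 2 ∂μ i) F (𝓝 0)) :
    TendstoZeroInProb (fun i => Measure.pi fun _ : Fin (n i) => μ i) F
      fun i y => ∑ j, f i (y j) - n i * ∫ y, f i y ∂μ i := by
  have hLp {i : ι} (hfi : MemLp (f i) 2 (μ i)) :
      MemLp (fun y : Fin (n i) → 𝒴 => ∑ j, f i (y j)) 2 (Measure.pi fun _ => μ i) :=
    memLp_finsetSum _ fun j _ =>
      hfi.comp_measurePreserving (measurePreserving_eval (fun _ : Fin (n i) => μ i) j)
  refine TendstoZeroInProb.of_pow (m := 2) (TendstoZeroInProb.of_integral_abs ?_ ?_)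
  · exact hf.mono fun i hfi => ((hLp hfi).sub (memLp_const _)).integrable_sq
  · refine squeeze_zero' (Eventually.of_forall fun _ => integral_nonneg fun _ => abs_nonneg _) ?_ h
    filter_upwards [hf] with i hfi
    have hmean := integral_sum_comp_eval_pi (κ := Fin (n i)) (hfi.integrable one_le_two)
    rw [Fintype.card_fin] at hmean
    simp only [abs_sq, ← hmean]
    rw [← variance_eq_integral (hLp hfi).aestronglyMeasurable.aemeasurable]
    simpa using variance_sum_comp_eval_pi_le (κ := Fin (n i)) hfi

end ProductSums

section CentralLimit

lemma norm_cexp_mul_I_sub_taylor_le (x : ℝ) :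
    ‖Complex.exp (x * Complex.I) - (1 + x * Complex.I - x ^ 2 / 2)‖ ≤ 4 * |x| ^ 3 := by
  have hnorm : ‖(x : ℂ) * Complex.I‖ = |x| := by simp
  rcases le_or_gt |x| 1 with hx | hx
  · have hbound := Complex.exp_bound (x := x * Complex.I) (by rwa [hnorm]) (n := 3) (by norm_num)
    have htaylor : ∑ m ∈ Finset.range 3, ((x : ℂ) * Complex.I) ^ m / (m.factorial : ℂ)
        = 1 + x * Complex.I - x ^ 2 / 2 := by
      simp [Finset.sum_range_succ, Nat.factorial, mul_pow]; ring
    rw [htaylor, hnorm] at hbound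
    refine hbound.trans ?_
    rw [mul_comm]
    gcongr
    norm_num [Nat.factorial]
  · have hexp : ‖Complex.exp (x * Complex.I)‖ = 1 := Complex.norm_exp_ofReal_mul_I x
    have hpoly : ‖(1 : ℂ) + x * Complex.I - x ^ 2 / 2‖ ≤ 1 + |x| + |x| ^ 2 / 2 := by
      refine (norm_sub_le _ _).trans (add_le_add ((norm_add_le _ _).trans ?_) ?_)
      · rw [hnorm, norm_one]
      · simp
    have h1 : |x| ≤ |x| ^ 3 := le_self_pow₀ hx.le (by norm_num)
    have h2 : |x| ^ 2 ≤ |x| ^ 3 := pow_le_pow_right₀ hx.le (by norm_num)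
    refine (norm_sub_le _ _).trans ?_
    rw [hexp]
    linarith

lemma norm_pow_sub_pow_le {𝕜 : Type*} [NormedField 𝕜] {a b : 𝕜} (ha : ‖a‖ ≤ 1) (hb : ‖b‖ ≤ 1)
    (n : ℕ) : ‖a ^ n - b ^ n‖ ≤ n * ‖a - b‖ := by
  induction n with
  | zero => simp
  | succ n ih =>
    have hsplit : a ^ (n + 1) - b ^ (n + 1) = (a ^ n - b ^ n) * a + b ^ n * (a - b) := by ring
    have h1 : ‖(a ^ n - b ^ n) * a‖ ≤ n * ‖a - b‖ := by
      rw [norm_mul]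
      exact (mul_le_of_le_one_right (norm_nonneg _) ha).trans ih
    have h2 : ‖b ^ n * (a - b)‖ ≤ ‖a - b‖ := by
      rw [norm_mul, norm_pow]
      exact mul_le_of_le_one_left (norm_nonneg _) (pow_le_one₀ (norm_nonneg _) hb)
    rw [hsplit]
    refine (norm_add_le _ _).trans ?_
    push_cast
    linarith

lemma abs_pow_three_le_one_add_pow_four (x : ℝ) : |x| ^ 3 ≤ 1 + x ^ 4 := by
  rw [← Even.pow_abs (by decide : Even 4)]
  rcases le_or_gt |x| 1 with hx | hx
  · linarith [pow_le_one₀ (abs_nonneg x) hx (n := 3), pow_nonneg (abs_nonneg x) 4]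
  · linarith [pow_le_pow_right₀ hx.le (by norm_num : 3 ≤ 4)]

variable {𝒴 : Type*} [MeasurableSpace 𝒴]

lemma integrable_pow_of_memLp_four {μ : Measure 𝒴} [IsFiniteMeasure μ] {ζ : 𝒴 → ℝ}
    (hζ : MemLp ζ 4 μ) {k : ℕ} (hk : k ≤ 4) : Integrable (fun y => ζ y ^ k) μ := by
  have hk' : MemLp ζ k μ := hζ.mono_exponent (by exact_mod_cast hk)
  refine (integrable_norm_iff (hζ.aestronglyMeasurable.pow k)).1 ?_
  simpa only [Pi.pow_apply, norm_pow] using hk'.integrable_norm_pow'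

lemma norm_integral_cexp_sub_le {μ : Measure 𝒴} [IsProbabilityMeasure μ] {ζ : 𝒴 → ℝ}
    (hζ : MemLp ζ 4 μ) (hmean : ∫ y, ζ y ∂μ = 0) (τ : ℝ) :
    ‖∫ y, Complex.exp ((τ * ζ y : ℝ) * Complex.I) ∂μ
      - ((1 - τ ^ 2 / 2 * ∫ y, ζ y ^ 2 ∂μ : ℝ) : ℂ)‖
      ≤ 4 * |τ| ^ 3 * (1 + ∫ y, ζ y ^ 4 ∂μ) := by
  have hint1 : Integrable (fun y => ((τ * ζ y : ℝ) : ℂ) * Complex.I) μ :=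
    ((hζ.integrable (by norm_num)).const_mul τ).ofReal.mul_const _
  have hint2 : Integrable (fun y => ((τ ^ 2 / 2 * ζ y ^ 2 : ℝ) : ℂ)) μ :=
    ((integrable_pow_of_memLp_four hζ (by norm_num)).const_mul _).ofReal
  have hint4 : Integrable (fun y => 4 * |τ| ^ 3 * (1 + ζ y ^ 4)) μ :=
    ((integrable_const 1).add (integrable_pow_of_memLp_four hζ le_rfl)).const_mul _
  have hexp : Integrable (fun y => Complex.exp ((τ * ζ y : ℝ) * Complex.I)) μ := by
    have hmeas := ((hζ.aestronglyMeasurable.const_mul τ).aemeasurable.complex_ofReal.mul_const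
      Complex.I).cexp.aestronglyMeasurable
    exact (integrable_const (1 : ℝ)).mono' hmeas
      (Eventually.of_forall fun y => (Complex.norm_exp_ofReal_mul_I _).le)
  have hlin : Integrable (fun y => (1 : ℂ) + ((τ * ζ y : ℝ) : ℂ) * Complex.I) μ :=
    (integrable_const _).add hint1
  have htaylor : ((1 - τ ^ 2 / 2 * ∫ y, ζ y ^ 2 ∂μ : ℝ) : ℂ)
      = ∫ y, ((1 : ℂ) + ((τ * ζ y : ℝ) : ℂ) * Complex.I - ((τ ^ 2 / 2 * ζ y ^ 2 : ℝ) : ℂ)) ∂μ := by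
    rw [integral_sub hlin hint2, integral_add (integrable_const _) hint1, integral_mul_const,
      integral_complex_ofReal, integral_complex_ofReal, integral_const_mul, integral_const_mul,
      hmean]
    simp
  rw [htaylor, ← integral_sub hexp (by exact hlin.sub hint2)]
  refine (norm_integral_le_of_norm_le hint4 (Eventually.of_forall fun y => ?_)).trans_eq ?_
  · calc _ = ‖Complex.exp ((τ * ζ y : ℝ) * Complex.I)
          - (1 + (τ * ζ y : ℝ) * Complex.I - (τ * ζ y : ℝ) ^ 2 / 2)‖ := by push_cast; ring_nf
      _ ≤ 4 * |τ| ^ 3 * |ζ y| ^ 3 := by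
        simpa only [abs_mul, mul_pow, mul_assoc] using norm_cexp_mul_I_sub_taylor_le (τ * ζ y)
      _ ≤ _ := by gcongr; exact abs_pow_three_le_one_add_pow_four _
  · rw [integral_const_mul, integral_add (integrable_const _)
      (integrable_pow_of_memLp_four hζ le_rfl)]
    simp

/-- The normalised sum `n^(-1/2) ∑ ζ (y j)` of a statistic `ζ` over a sample `y` of size `n`. -/
noncomputable def normalizedSum (n : ℕ) (ζ : 𝒴 → ℝ) (y : Fin n → 𝒴) : ℝ := (∑ j, ζ (y j)) / √n

@[fun_prop]
lemma measurable_normalizedSum {n : ℕ} {ζ : 𝒴 → ℝ} (hζ : Measurable ζ) :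
    Measurable (normalizedSum n ζ) := by
  unfold normalizedSum; fun_prop

lemma charFun_map_normalizedSum {μ : Measure 𝒴} [IsProbabilityMeasure μ] {ζ : 𝒴 → ℝ}
    (hζ : Measurable ζ) (n : ℕ) (t : ℝ) :
    charFun ((Measure.pi fun _ : Fin n => μ).map (normalizedSum n ζ)) t
      = (∫ y, Complex.exp ((t / √n * ζ y : ℝ) * Complex.I) ∂μ) ^ n := by
  have hprod := integral_fintype_prod_eq_pow (ι := Fin n) (μ := μ)
    fun y => Complex.exp ((t / √n * ζ y : ℝ) * Complex.I)
  rw [Fintype.card_fin] at hprod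
  rw [charFun_apply_real, integral_map (measurable_normalizedSum hζ).aemeasurable
    (Continuous.aestronglyMeasurable (by fun_prop)), ← hprod]
  congr 1; ext y
  rw [← Complex.exp_sum, ← Finset.sum_mul, normalizedSum, ← Complex.ofReal_sum, ← Finset.mul_sum]
  congr 2
  push_cast
  ring

lemma abs_one_sub_mul_sub_exp_neg_le {s : ℝ} (hs0 : 0 ≤ s) (hs1 : s ≤ 1) (m : ℝ) :
    |1 - s * m - Real.exp (-s)| ≤ s * |m - 1| + s ^ 2 := by
  have hexp := Real.abs_exp_sub_one_sub_id_le (x := -s) (by rwa [abs_neg, abs_of_nonneg hs0])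
  rw [show 1 - s * m - Real.exp (-s) = -(s * (m - 1)) - (Real.exp (-s) - 1 - -s) by ring]
  refine (abs_sub _ _).trans (add_le_add ?_ (hexp.trans_eq (neg_sq s)))
  rw [abs_neg, abs_mul, abs_of_nonneg hs0]

lemma norm_integral_cexp_sub_exp_le {μ : Measure 𝒴} [IsProbabilityMeasure μ] {ζ : 𝒴 → ℝ}
    (hζ4 : MemLp ζ 4 μ) (hmean : ∫ y, ζ y ∂μ = 0) {τ : ℝ} (hτ : τ ^ 2 / 2 ≤ 1) :
    ‖∫ y, Complex.exp ((τ * ζ y : ℝ) * Complex.I) ∂μ - (Real.exp (-(τ ^ 2 / 2)) : ℝ)‖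
      ≤ 4 * |τ| ^ 3 * (1 + ∫ y, ζ y ^ 4 ∂μ)
        + (τ ^ 2 / 2 * |∫ y, ζ y ^ 2 ∂μ - 1| + (τ ^ 2 / 2) ^ 2) := by
  refine (norm_sub_le_norm_sub_add_norm_sub _ _ _).trans
    (add_le_add (norm_integral_cexp_sub_le hζ4 hmean τ) ?_)
  rw [← Complex.ofReal_sub, Complex.norm_real]
  exact abs_one_sub_mul_sub_exp_neg_le (by positivity) hτ _

lemma norm_charFun_map_normalizedSum_sub_le {μ : Measure 𝒴} [IsProbabilityMeasure μ] {ζ : 𝒴 → ℝ}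
    (hζ : Measurable ζ) (hζ4 : MemLp ζ 4 μ) (hmean : ∫ y, ζ y ∂μ = 0) {n : ℕ} (hn : 1 ≤ n)
    {t : ℝ} (ht : t ^ 2 ≤ n) :
    ‖charFun ((Measure.pi fun _ : Fin n => μ).map (normalizedSum n ζ)) t
        - Complex.exp (-t ^ 2 / 2)‖
      ≤ 4 * |t| ^ 3 * (1 + ∫ y, ζ y ^ 4 ∂μ) / √n + t ^ 2 / 2 * |∫ y, ζ y ^ 2 ∂μ - 1|
        + t ^ 4 / (4 * n) := by
  have hn0 : (0 : ℝ) < n := by exact_mod_cast hn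
  have hs : √(n : ℝ) ^ 2 = n := Real.sq_sqrt hn0.le
  set τ := t / √n with hτ
  have hτ2 : τ ^ 2 / 2 = t ^ 2 / (2 * n) := by rw [hτ, div_pow, hs]; field_simp
  have hτ3 : n * |τ| ^ 3 = |t| ^ 3 / √n := by
    rw [hτ, abs_div, abs_of_nonneg (Real.sqrt_nonneg _), div_pow]
    nth_rw 1 [← hs]; field_simp
  have hτ1 : τ ^ 2 / 2 ≤ 1 := hτ2 ▸ (div_le_one (by positivity)).2 (by linarith)
  set a := ∫ y, Complex.exp ((τ * ζ y : ℝ) * Complex.I) ∂μ with ha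
  have hpow : ((Real.exp (-(τ ^ 2 / 2)) : ℝ) : ℂ) ^ n = Complex.exp (-t ^ 2 / 2) := by
    rw [← Complex.ofReal_pow, ← Real.exp_nat_mul, hτ2,
      show n * -(t ^ 2 / (2 * n)) = -t ^ 2 / 2 by field_simp]
    push_cast; rfl
  have ha1 : ‖a‖ ≤ 1 := by
    simpa [ha] using norm_integral_le_of_norm_le_const (μ := μ) (C := 1)
      (Eventually.of_forall fun y => (Complex.norm_exp_ofReal_mul_I (τ * ζ y)).le)
  have hb1 : ‖((Real.exp (-(τ ^ 2 / 2)) : ℝ) : ℂ)‖ ≤ 1 := by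
    rw [Complex.norm_real, Real.norm_of_nonneg (Real.exp_pos _).le, Real.exp_le_one_iff]
    exact neg_nonpos.2 (by positivity)
  rw [charFun_map_normalizedSum hζ, ← hpow]
  refine (norm_pow_sub_pow_le ha1 hb1 n).trans ((mul_le_mul_of_nonneg_left
    (norm_integral_cexp_sub_exp_le hζ4 hmean hτ1) hn0.le).trans_eq ?_)
  calc _ = n * |τ| ^ 3 * (4 * (1 + ∫ y, ζ y ^ 4 ∂μ))
        + n * (τ ^ 2 / 2) * |∫ y, ζ y ^ 2 ∂μ - 1| + n * (τ ^ 2 / 2) ^ 2 := by ring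
    _ = _ := by rw [hτ3, hτ2]; field_simp; ring

variable {ι : Type*} {F : Filter ι} {n : ι → ℕ} {μ : ι → Measure 𝒴}
  {ζ : ι → 𝒴 → ℝ}

/-- The statistics `ζ i` are, along the filter `F`, centred with variance tending to `1` and with
bounded fourth moment under `μ i`. These are the conditions on the rows of a triangular array under
which the central limit theorem holds, and under which `ζ` can serve as a score. -/
structure IsAsymptoticallyStandard (F : Filter ι) (μ : ι → Measure 𝒴) (ζ : ι → 𝒴 → ℝ) : Prop where
  measurable : ∀ i, Measurable (ζ i)
  memLp_four : ∀ i, MemLp (ζ i) 4 (μ i)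
  integral_eq_zero : ∀ᶠ i in F, ∫ y, ζ i y ∂μ i = 0
  tendsto_integral_sq : Tendsto (fun i => ∫ y, ζ i y ^ 2 ∂μ i) F (𝓝 1)
  exists_integral_pow_four_le : ∃ C, ∀ᶠ i in F, ∫ y, ζ i y ^ 4 ∂μ i ≤ C

namespace IsAsymptoticallyStandard

lemma comp {κ : Type*} {G : Filter κ} {k : κ → ι} (hζ : IsAsymptoticallyStandard F μ ζ)
    (hk : Tendsto k G F) : IsAsymptoticallyStandard G (μ ∘ k) (ζ ∘ k) where
  measurable i := hζ.measurable (k i)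
  memLp_four i := hζ.memLp_four (k i)
  integral_eq_zero := hk.eventually hζ.integral_eq_zero
  tendsto_integral_sq := hζ.tendsto_integral_sq.comp hk
  exists_integral_pow_four_le := hζ.exists_integral_pow_four_le.imp fun _ => hk.eventually

variable [∀ i, IsProbabilityMeasure (μ i)]

lemma tendsto_charFun (hζ : IsAsymptoticallyStandard F μ ζ) (hn : Tendsto n F atTop) (t : ℝ) :
    Tendsto (fun i => charFun ((Measure.pi fun _ : Fin (n i) => μ i).map
      (normalizedSum (n i) (ζ i))) t) F (𝓝 (Complex.exp (-t ^ 2 / 2))) := by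
  have hn' : Tendsto (fun i => (n i : ℝ)) F atTop := tendsto_natCast_atTop_atTop.comp hn
  obtain ⟨C, hC⟩ := hζ.exists_integral_pow_four_le
  rw [tendsto_iff_norm_sub_tendsto_zero]
  refine squeeze_zero' (Eventually.of_forall fun i => norm_nonneg _)
    (g := fun i => 4 * |t| ^ 3 * (1 + C) / √(n i) + t ^ 2 / 2 * |∫ y, ζ i y ^ 2 ∂μ i - 1|
      + t ^ 4 / (4 * n i)) ?_ ?_
  · filter_upwards [hζ.integral_eq_zero, hC, hn.eventually_ge_atTop 1,
      hn'.eventually_ge_atTop (t ^ 2)] with i hmean hCi hn1 hnt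
    refine (norm_charFun_map_normalizedSum_sub_le (hζ.measurable i) (hζ.memLp_four i) hmean hn1
      hnt).trans ?_
    gcongr
  · have h1 : Tendsto (fun i => 4 * |t| ^ 3 * (1 + C) / √(n i)) F (𝓝 0) :=
      (Real.tendsto_sqrt_atTop.comp hn').const_div_atTop _
    have h2 : Tendsto (fun i => t ^ 2 / 2 * |∫ y, ζ i y ^ 2 ∂μ i - 1|) F (𝓝 0) := by
      simpa using ((hζ.tendsto_integral_sq.sub_const 1).abs).const_mul (t ^ 2 / 2)
    have h3 : Tendsto (fun i => t ^ 4 / (4 * (n i : ℝ))) F (𝓝 0) :=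
      (hn'.const_mul_atTop (by norm_num)).const_div_atTop _
    simpa using (h1.add h2).add h3

theorem tendsto_integral_normalizedSum [F.IsCountablyGenerated]
    (hζ : IsAsymptoticallyStandard F μ ζ) (hn : Tendsto n F atTop) (g : ℝ →ᵇ ℝ) :
    Tendsto (fun i => ∫ y, g (normalizedSum (n i) (ζ i) y) ∂Measure.pi fun _ => μ i) F
      (𝓝 (∫ x, g x ∂(gaussianReal 0 1))) := by
  refine tendsto_of_seq_tendsto fun k hk => ?_
  have hmeas (i : ι) := measurable_normalizedSum (n := n i) (hζ.measurable i)
  let law (j : ℕ) : ProbabilityMeasure ℝ :=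
    ⟨(Measure.pi fun _ => μ (k j)).map (normalizedSum (n (k j)) (ζ (k j))),
      Measure.isProbabilityMeasure_map (hmeas (k j)).aemeasurable⟩
  let gaussian : ProbabilityMeasure ℝ := ⟨gaussianReal 0 1, inferInstance⟩
  have hlaw : Tendsto law atTop (𝓝 gaussian) := by
    refine ProbabilityMeasure.tendsto_iff_tendsto_charFun.2 fun t => ?_
    have : ∀ j, IsProbabilityMeasure ((μ ∘ k) j) := fun j => inferInstanceAs
      (IsProbabilityMeasure (μ (k j)))
    simpa [law, gaussian, charFun_gaussianReal, neg_div] using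
      (hζ.comp hk).tendsto_charFun (hn.comp hk) t
  exact (ProbabilityMeasure.tendsto_iff_forall_integral_tendsto.1 hlaw g).congr fun j =>
    integral_map (hmeas (k j)).aemeasurable g.continuous.aestronglyMeasurable

end IsAsymptoticallyStandard

end CentralLimit

section LocalExpansion

variable {𝒴 : Type*} [MeasurableSpace 𝒴] {μ : Measure 𝒴} {ρ ζ : 𝒴 → ℝ}

lemma sqrt_sub_one_sq_le {x : ℝ} (hx : 0 ≤ x) : (√x - 1) ^ 2 ≤ 1 + x := by
  nlinarith [Real.sq_sqrt hx, Real.sqrt_nonneg x]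

lemma abs_log_sub_two_mul_add_sq_le {x : ℝ} (hx : 0 ≤ x) (h : |√x - 1| ≤ 1 / 2) :
    |Real.log x - 2 * (√x - 1) + (√x - 1) ^ 2| ≤ 4 * |√x - 1| * (√x - 1) ^ 2 := by
  set z := √x - 1 with hz
  have htaylor := Real.abs_log_sub_add_sum_range_le (x := -z) (by rw [abs_neg]; linarith) 2
  have hlog : Real.log x = 2 * Real.log (1 - -z) := by
    rw [sub_neg_eq_add, hz, add_sub_cancel, Real.log_sqrt hx]; ring
  have hsum : (∑ m ∈ Finset.range 2, (-z) ^ (m + 1) / (m + 1 : ℝ)) + Real.log (1 - -z)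
      = (Real.log x - 2 * z + z ^ 2) / 2 := by
    rw [hlog, Finset.sum_range_succ, Finset.sum_range_one]; push_cast; ring
  rw [hsum, abs_div, abs_neg, abs_two, div_le_iff₀ two_pos] at htaylor
  refine htaylor.trans ?_
  have hpow : |z| ^ (2 + 1) = |z| * z ^ 2 := by rw [pow_succ', sq_abs]
  rw [hpow, div_mul_eq_mul_div, div_le_iff₀ (by linarith)]
  nlinarith [mul_nonneg (abs_nonneg z) (sq_nonneg z)]

lemma memLp_sqrt_sub_one [IsFiniteMeasure μ] (hmeas : Measurable ρ) (h0 : ∀ y, 0 ≤ ρ y)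
    (h_int : Integrable ρ μ) : MemLp (fun y => √(ρ y) - 1) 2 μ := by
  refine (memLp_two_iff_integrable_sq (by fun_prop)).2 ?_
  refine ((integrable_const 1).add h_int).mono' (by fun_prop) (Eventually.of_forall fun y => ?_)
  rw [Real.norm_of_nonneg (sq_nonneg _)]
  exact sqrt_sub_one_sq_le (h0 y)

lemma integral_sqrt_sub_one [IsProbabilityMeasure μ] (hmeas : Measurable ρ) (h0 : ∀ y, 0 ≤ ρ y)
    (hone : ∫ y, ρ y ∂μ = 1) :
    ∫ y, (√(ρ y) - 1) ∂μ = -(∫ y, (√(ρ y) - 1) ^ 2 ∂μ) / 2 := by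
  have h_int : Integrable ρ μ := .of_integral_ne_zero (by rw [hone]; exact one_ne_zero)
  have hZ := memLp_sqrt_sub_one hmeas h0 h_int
  have hexpand (y : 𝒴) : ρ y - 1 = (√(ρ y) - 1) ^ 2 + 2 * (√(ρ y) - 1) := by
    linear_combination -Real.sq_sqrt (h0 y)
  have hzero : ∫ y, (ρ y - 1) ∂μ = 0 := by
    rw [integral_sub h_int (integrable_const _), hone]; simp
  simp only [hexpand] at hzero
  rw [integral_add hZ.integrable_sq ((hZ.integrable one_le_two).const_mul 2),
    integral_const_mul] at hzero
  linarith

lemma abs_le_add_pow_four_div {A : ℝ} (hA : 0 < A) (x : ℝ) : |x| ≤ A + x ^ 4 / A ^ 3 := by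
  rcases le_or_gt |x| A with hx | hx
  · exact hx.trans (le_add_of_nonneg_right (by positivity))
  · have hpow : |x| ≤ x ^ 4 / A ^ 3 := by
      rw [le_div_iff₀ (by positivity), ← Even.pow_abs (by decide : Even 4) x, pow_succ' |x| 3]
      gcongr
    linarith

lemma sqrt_sub_one_sq_mul_abs_le {r A : ℝ} (hr : 0 ≤ r) (hA : 0 < A) (x : ℝ) :
    (√r - 1) ^ 2 * |x| ≤ A * (√r - 1) ^ 2 + (x ^ 4 + r * x ^ 4) / A ^ 3 :=
  calc (√r - 1) ^ 2 * |x| ≤ (√r - 1) ^ 2 * (A + x ^ 4 / A ^ 3) := by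
        gcongr; exact abs_le_add_pow_four_div hA _
    _ = A * (√r - 1) ^ 2 + (√r - 1) ^ 2 * x ^ 4 / A ^ 3 := by ring
    _ ≤ A * (√r - 1) ^ 2 + (1 + r) * x ^ 4 / A ^ 3 := by
        gcongr; exact sqrt_sub_one_sq_le hr
    _ = _ := by ring

lemma integrable_mul_of_integrable_mul_pow_four (hρ : Measurable ρ) (h0 : ∀ y, 0 ≤ ρ y)
    (h_int : Integrable ρ μ) (hζ : Measurable ζ) (hρζ : Integrable (fun y => ρ y * ζ y ^ 4) μ) :
    Integrable (fun y => ρ y * ζ y) μ := by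
  refine (h_int.add hρζ).mono' (by fun_prop) (Eventually.of_forall fun y => ?_)
  rw [Real.norm_eq_abs, abs_mul, abs_of_nonneg (h0 y), Pi.add_apply]
  nlinarith [mul_le_mul_of_nonneg_left (abs_le_add_pow_four_div one_pos (ζ y)) (h0 y)]

lemma abs_integral_mul_sub_two_mul_integral_sqrt_mul_le [IsProbabilityMeasure μ]
    (hmeas : Measurable ρ) (h0 : ∀ y, 0 ≤ ρ y) (h_int : Integrable ρ μ) (hζ : Measurable ζ)
    (hζ4 : MemLp ζ 4 μ) (hρζ : Integrable (fun y => ρ y * ζ y ^ 4) μ) {A : ℝ} (hA : 0 < A) :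
    |∫ y, ρ y * ζ y ∂μ - ∫ y, ζ y ∂μ - 2 * ∫ y, (√(ρ y) - 1) * ζ y ∂μ|
      ≤ A * ∫ y, (√(ρ y) - 1) ^ 2 ∂μ
        + (∫ y, ζ y ^ 4 ∂μ + ∫ y, ρ y * ζ y ^ 4 ∂μ) / A ^ 3 := by
  have hZ := memLp_sqrt_sub_one hmeas h0 h_int
  have hζ1 : Integrable ζ μ := hζ4.integrable (by norm_num)
  have hζ4' : Integrable (fun y => ζ y ^ 4) μ := integrable_pow_of_memLp_four hζ4 le_rfl
  have hZζ : Integrable (fun y => (√(ρ y) - 1) * ζ y) μ :=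
    hZ.integrable_mul (hζ4.mono_exponent (p := 2) (by norm_num))
  have hρζ1 := integrable_mul_of_integrable_mul_pow_four hmeas h0 h_int hζ hρζ
  have hsquare (y : 𝒴) :
      ρ y * ζ y - ζ y - 2 * ((√(ρ y) - 1) * ζ y) = (√(ρ y) - 1) ^ 2 * ζ y := by
    linear_combination -ζ y * Real.sq_sqrt (h0 y)
  rw [← integral_const_mul, ← integral_sub hρζ1 hζ1,
    ← integral_sub (by exact hρζ1.sub hζ1) (hZζ.const_mul 2)]
  simp only [hsquare]
  have hbound : Integrable (fun y => A * (√(ρ y) - 1) ^ 2 + (ζ y ^ 4 + ρ y * ζ y ^ 4) / A ^ 3) μ :=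
    (hZ.integrable_sq.const_mul A).add ((hζ4'.add hρζ).div_const _)
  rw [← Real.norm_eq_abs]
  refine (norm_integral_le_of_norm_le hbound (Eventually.of_forall fun y => ?_)).trans_eq ?_
  · rw [norm_mul, Real.norm_of_nonneg (sq_nonneg _)]
    exact sqrt_sub_one_sq_mul_abs_le (h0 y) hA _
  · rw [integral_add (hZ.integrable_sq.const_mul A) (by exact (hζ4'.add hρζ).div_const _),
      integral_const_mul, integral_div, integral_add hζ4' hρζ]

/-- The error of the first-order approximation of the root `√ρ` of a density ratio, for samples of
size `n`, by `1 + v ζ / (2 √n)`. That `n ∫ quadraticMeanError² → 0` is the triangular-array form of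
differentiability in quadratic mean with score `ζ`. -/
noncomputable def quadraticMeanError (n : ℕ) (v : ℝ) (ζ ρ : 𝒴 → ℝ) (y : 𝒴) : ℝ :=
  √(ρ y) - 1 - v / (2 * √n) * ζ y

lemma memLp_quadraticMeanError [IsFiniteMeasure μ] (hmeas : Measurable ρ) (h0 : ∀ y, 0 ≤ ρ y)
    (h_int : Integrable ρ μ) (hζ : MemLp ζ 2 μ) (n : ℕ) (v : ℝ) :
    MemLp (quadraticMeanError n v ζ ρ) 2 μ :=
  (memLp_sqrt_sub_one hmeas h0 h_int).sub (hζ.const_mul _)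

lemma mul_integral_quadraticMeanError_sq [IsFiniteMeasure μ] (hmeas : Measurable ρ)
    (h0 : ∀ y, 0 ≤ ρ y) (h_int : Integrable ρ μ) (hζ : MemLp ζ 2 μ) {n : ℕ} (hn : n ≠ 0) (v : ℝ) :
    n * ∫ y, quadraticMeanError n v ζ ρ y ^ 2 ∂μ
      = n * ∫ y, (√(ρ y) - 1) ^ 2 ∂μ - v * (√n * ∫ y, (√(ρ y) - 1) * ζ y ∂μ)
        + v ^ 2 / 4 * ∫ y, ζ y ^ 2 ∂μ := by
  have hZ := memLp_sqrt_sub_one hmeas h0 h_int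
  have hZζ : Integrable (fun y => (√(ρ y) - 1) * ζ y) μ := hZ.integrable_mul hζ
  have hs0 : √(n : ℝ) ≠ 0 := by positivity
  have hs : (n : ℝ) = √n ^ 2 := (Real.sq_sqrt n.cast_nonneg).symm
  set s := √(n : ℝ)
  have hexpand (y : 𝒴) : quadraticMeanError n v ζ ρ y ^ 2 = (√(ρ y) - 1) ^ 2
      - v / s * ((√(ρ y) - 1) * ζ y) + v ^ 2 / (4 * s ^ 2) * ζ y ^ 2 := by
    simp only [quadraticMeanError]; field_simp; ring
  simp only [hexpand]
  rw [integral_add (by exact hZ.integrable_sq.sub (hZζ.const_mul _))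
      (hζ.integrable_sq.const_mul _),
    integral_sub hZ.integrable_sq (hZζ.const_mul _), integral_const_mul, integral_const_mul]
  rw [hs]
  field_simp

end LocalExpansion

section LocalAsymptoticNormality

variable {ι : Type*} {F : Filter ι} {𝒴 : Type*} [MeasurableSpace 𝒴] {n : ι → ℕ}
  {μ : ι → Measure 𝒴} {ζ ρ : ι → 𝒴 → ℝ} {v : ℝ}

/-- The densities `ρ i`, with respect to `μ i`, of local alternatives that respond to the score `ζ`
at the rate `v / √n`, and whose squared Hellinger distance from `μ i` is asymptotically no larger
than this response forces it to be: `limsup n ∫ (√ρ - 1)² ≤ v² / 4`. -/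
structure IsLocalAlternative (F : Filter ι) (n : ι → ℕ) (μ : ι → Measure 𝒴) (ζ : ι → 𝒴 → ℝ)
    (v : ℝ) (ρ : ι → 𝒴 → ℝ) : Prop where
  measurable : ∀ i, Measurable (ρ i)
  nonneg : ∀ i y, 0 ≤ ρ i y
  integral_eq_one : ∀ᶠ i in F, ∫ y, ρ i y ∂μ i = 1
  integrable_mul_pow_four : ∀ᶠ i in F, Integrable (fun y => ρ i y * ζ i y ^ 4) (μ i)
  exists_integral_mul_pow_four_le : ∃ C, ∀ᶠ i in F, ∫ y, ρ i y * ζ i y ^ 4 ∂μ i ≤ C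
  tendsto_sqrt_mul_integral : Tendsto (fun i => √(n i) * ∫ y, ρ i y * ζ i y ∂μ i) F (𝓝 v)
  exists_hellinger_le : ∃ b : ι → ℝ, Tendsto b F (𝓝 (v ^ 2 / 4)) ∧
    ∀ᶠ i in F, n i * ∫ y, (√(ρ i y) - 1) ^ 2 ∂μ i ≤ b i

namespace IsLocalAlternative

lemma integrable (hρ : IsLocalAlternative F n μ ζ v ρ) : ∀ᶠ i in F, Integrable (ρ i) (μ i) :=
  hρ.integral_eq_one.mono fun _ hi => .of_integral_ne_zero (by rw [hi]; exact one_ne_zero)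

variable [∀ i, IsProbabilityMeasure (μ i)]

lemma tendsto_sqrt_mul_integral_sqrt_mul (hρ : IsLocalAlternative F n μ ζ v ρ)
    (hζ : IsAsymptoticallyStandard F μ ζ) (hn : Tendsto n F atTop) :
    Tendsto (fun i => √(n i) * ∫ y, (√(ρ i y) - 1) * ζ i y ∂μ i) F (𝓝 (v / 2)) := by
  obtain ⟨b, hb, hhell⟩ := hρ.exists_hellinger_le
  obtain ⟨C, hC⟩ := hζ.exists_integral_pow_four_le
  obtain ⟨K, hK⟩ := hρ.exists_integral_mul_pow_four_le
  have hroot : Tendsto (fun i => √√(n i : ℝ)) F atTop := Real.tendsto_sqrt_atTop.comp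
    (Real.tendsto_sqrt_atTop.comp (tendsto_natCast_atTop_atTop.comp hn))
  have hdiff : Tendsto (fun i => √(n i) * ∫ y, ρ i y * ζ i y ∂μ i
      - 2 * (√(n i) * ∫ y, (√(ρ i y) - 1) * ζ i y ∂μ i)) F (𝓝 0) := by
    refine squeeze_zero_norm' ?_ ((hb.add_const (C + K)).div_atTop hroot)
    filter_upwards [hρ.integrable, hρ.integrable_mul_pow_four, hζ.integral_eq_zero, hhell, hC, hK,
      hn.eventually_ge_atTop 1] with i h_int hint4 hmean hbi hCi hKi hni
    set A := √√(n i : ℝ)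
    have hA : 0 < A := Real.sqrt_pos.2 (Real.sqrt_pos.2 (by exact_mod_cast hni))
    have hA2 : √(n i : ℝ) = A ^ 2 := (Real.sq_sqrt (Real.sqrt_nonneg _)).symm
    have hA4 : (n i : ℝ) = A ^ 4 := by
      rw [← Real.sq_sqrt (n i).cast_nonneg, hA2]; ring
    have hcross := abs_integral_mul_sub_two_mul_integral_sqrt_mul_le (hρ.measurable i)
      (hρ.nonneg i) h_int (hζ.measurable i) (hζ.memLp_four i) hint4 hA
    rw [hmean, sub_zero] at hcross
    rw [hA4] at hbi
    rw [hA2, Real.norm_eq_abs, show ∀ x z : ℝ, A ^ 2 * x - 2 * (A ^ 2 * z) = A ^ 2 * (x - 2 * z) by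
      intros; ring, abs_mul, abs_of_pos (pow_pos hA 2)]
    calc _ ≤ A ^ 2 * (A * ∫ y, (√(ρ i y) - 1) ^ 2 ∂μ i + (C + K) / A ^ 3) := by
          gcongr; exact hcross.trans (by gcongr)
      _ = (A ^ 4 * ∫ y, (√(ρ i y) - 1) ^ 2 ∂μ i + (C + K)) / A := by field_simp
      _ ≤ _ := by gcongr
  simpa using (hρ.tendsto_sqrt_mul_integral.sub hdiff).div_const 2

lemma eventually_mul_integral_quadraticMeanError_sq (hρ : IsLocalAlternative F n μ ζ v ρ)
    (hζ : IsAsymptoticallyStandard F μ ζ) (hn : Tendsto n F atTop) : ∀ᶠ i in F,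
    n i * ∫ y, quadraticMeanError (n i) v (ζ i) (ρ i) y ^ 2 ∂μ i
      = n i * ∫ y, (√(ρ i y) - 1) ^ 2 ∂μ i - v * (√(n i) * ∫ y, (√(ρ i y) - 1) * ζ i y ∂μ i)
        + v ^ 2 / 4 * ∫ y, ζ i y ^ 2 ∂μ i := by
  filter_upwards [hρ.integrable, hn.eventually_ge_atTop 1] with i h_int hni
  exact mul_integral_quadraticMeanError_sq (hρ.measurable i) (hρ.nonneg i) h_int
    ((hζ.memLp_four i).mono_exponent (by norm_num)) (by omega) v

lemma tendsto_mul_integral_quadraticMeanError_sq (hρ : IsLocalAlternative F n μ ζ v ρ)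
    (hζ : IsAsymptoticallyStandard F μ ζ) (hn : Tendsto n F atTop) :
    Tendsto (fun i => (n i : ℝ) * ∫ y, quadraticMeanError (n i) v (ζ i) (ρ i) y ^ 2 ∂μ i) F
      (𝓝 0) := by
  obtain ⟨b, hb, hhell⟩ := hρ.exists_hellinger_le
  have hlim := (hb.sub ((hρ.tendsto_sqrt_mul_integral_sqrt_mul hζ hn).const_mul v)).add
    (hζ.tendsto_integral_sq.const_mul (v ^ 2 / 4))
  rw [show v ^ 2 / 4 - v * (v / 2) + v ^ 2 / 4 * 1 = 0 by ring] at hlim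
  refine squeeze_zero' (Eventually.of_forall fun i => ?_) ?_ hlim
  · exact mul_nonneg (Nat.cast_nonneg _) (integral_nonneg fun _ => sq_nonneg _)
  · filter_upwards [hρ.eventually_mul_integral_quadraticMeanError_sq hζ hn, hhell]
      with i hexpand hbi
    rw [hexpand]
    gcongr

lemma tendsto_mul_integral_sqrt_sub_one_sq (hρ : IsLocalAlternative F n μ ζ v ρ)
    (hζ : IsAsymptoticallyStandard F μ ζ) (hn : Tendsto n F atTop) :
    Tendsto (fun i => (n i : ℝ) * ∫ y, (√(ρ i y) - 1) ^ 2 ∂μ i) F (𝓝 (v ^ 2 / 4)) := by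
  have hlim := ((hρ.tendsto_mul_integral_quadraticMeanError_sq hζ hn).add
    ((hρ.tendsto_sqrt_mul_integral_sqrt_mul hζ hn).const_mul v)).sub
    (hζ.tendsto_integral_sq.const_mul (v ^ 2 / 4))
  rw [show 0 + v * (v / 2) - v ^ 2 / 4 * 1 = v ^ 2 / 4 by ring] at hlim
  refine hlim.congr' ?_
  filter_upwards [hρ.eventually_mul_integral_quadraticMeanError_sq hζ hn] with i hexpand
  rw [hexpand]
  ring

lemma tendsto_mul_integral_quadraticMeanError (hρ : IsLocalAlternative F n μ ζ v ρ)
    (hζ : IsAsymptoticallyStandard F μ ζ) (hn : Tendsto n F atTop) :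
    Tendsto (fun i => (n i : ℝ) * ∫ y, quadraticMeanError (n i) v (ζ i) (ρ i) y ∂μ i) F
      (𝓝 (-(v ^ 2 / 8))) := by
  have hlim := (hρ.tendsto_mul_integral_sqrt_sub_one_sq hζ hn).div_const (-2)
  rw [show v ^ 2 / 4 / -2 = -(v ^ 2 / 8) by ring] at hlim
  refine hlim.congr' ?_
  filter_upwards [hρ.integral_eq_one, hρ.integrable, hζ.integral_eq_zero] with i hone h_int hmean
  have hZ := (memLp_sqrt_sub_one (hρ.measurable i) (hρ.nonneg i) h_int).integrable one_le_two
  have hζ1 : Integrable (ζ i) (μ i) := (hζ.memLp_four i).integrable (by norm_num)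
  simp only [quadraticMeanError]
  rw [integral_sub hZ (hζ1.const_mul _), integral_const_mul, hmean,
    integral_sqrt_sub_one (hρ.measurable i) (hρ.nonneg i) hone]
  ring

end IsLocalAlternative

lemma IsAsymptoticallyStandard.tendsto_mul_integral_linear_pow_four
    (hζ : IsAsymptoticallyStandard F μ ζ) (hn : Tendsto n F atTop) (v : ℝ) :
    Tendsto (fun i => (n i : ℝ) * ∫ y, (v / (2 * √(n i)) * ζ i y) ^ 4 ∂μ i) F (𝓝 0) := by
  obtain ⟨C, hC⟩ := hζ.exists_integral_pow_four_le
  have hn' : Tendsto (fun i => (n i : ℝ)) F atTop := tendsto_natCast_atTop_atTop.comp hn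
  refine squeeze_zero' (Eventually.of_forall fun i => ?_) ?_
    (hn'.const_div_atTop (v ^ 4 / 16 * C))
  · exact mul_nonneg (Nat.cast_nonneg _) (integral_nonneg fun _ => by positivity)
  · filter_upwards [hC, hn.eventually_ge_atTop 1] with i hCi hni
    have hn0 : (n i : ℝ) ≠ 0 := by positivity
    have hs : √(n i : ℝ) ^ 4 = n i ^ 2 := by
      rw [show √(n i : ℝ) ^ 4 = (√(n i : ℝ) ^ 2) ^ 2 by ring, Real.sq_sqrt (n i).cast_nonneg]
    simp only [mul_pow, div_pow]
    rw [integral_const_mul, hs]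
    calc _ = v ^ 4 / 16 * (∫ y, ζ i y ^ 4 ∂μ i) / n i := by field_simp; ring
      _ ≤ _ := by gcongr

variable [∀ i, IsProbabilityMeasure (μ i)]

lemma IsAsymptoticallyStandard.tendstoZeroInProb_sum_linear_sq
    (hζ : IsAsymptoticallyStandard F μ ζ) (hn : Tendsto n F atTop) (v : ℝ) :
    TendstoZeroInProb (fun i => Measure.pi fun _ : Fin (n i) => μ i) F
      fun i y => ∑ j, (v / (2 * √(n i)) * ζ i (y j)) ^ 2 - v ^ 2 / 4 := by
  have hmem (i : ι) : MemLp (fun y => (v / (2 * √(n i)) * ζ i y) ^ 2) 2 (μ i) := by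
    have hmeas := hζ.measurable i
    refine (memLp_two_iff_integrable_sq (by fun_prop)).2 ?_
    simpa only [← pow_mul, mul_pow] using
      (integrable_pow_of_memLp_four (hζ.memLp_four i) le_rfl).const_mul ((v / (2 * √(n i))) ^ 4)
  have hcentred := tendstoZeroInProb_sum_sub_of_integral_sq (Eventually.of_forall hmem)
    (by simpa only [← pow_mul] using hζ.tendsto_mul_integral_linear_pow_four hn v)
  have hmean : Tendsto (fun i => (n i : ℝ) * ∫ y, (v / (2 * √(n i)) * ζ i y) ^ 2 ∂μ i - v ^ 2 / 4) F
      (𝓝 0) := by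
    have hlim := (hζ.tendsto_integral_sq.const_mul (v ^ 2 / 4)).sub_const (v ^ 2 / 4)
    rw [mul_one, sub_self] at hlim
    refine hlim.congr' ?_
    filter_upwards [hn.eventually_ge_atTop 1] with i hni
    have hn0 : (n i : ℝ) ≠ 0 := by positivity
    simp only [mul_pow, div_pow]
    rw [integral_const_mul, Real.sq_sqrt (n i).cast_nonneg]
    field_simp
    ring
  refine (hcentred.add (.of_tendsto hmean)).mono (Eventually.of_forall fun i y => le_of_eq ?_)
  ring_nf

lemma integral_abs_sq_sub_sq_le {ν : Measure 𝒴} {f g : 𝒴 → ℝ} (hf : MemLp f 2 ν)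
    (hg : MemLp g 2 ν) :
    ∫ y, |f y ^ 2 - g y ^ 2| ∂ν ≤ ∫ y, (f y - g y) ^ 2 ∂ν
      + 2 * (√(∫ y, (f y - g y) ^ 2 ∂ν) * √(∫ y, g y ^ 2 ∂ν)) := by
  have hd : MemLp (f - g) 2 ν := hf.sub hg
  have hcs := integral_mul_norm_le_Lp_mul_Lq (μ := ν) (f := f - g) (g := g)
    Real.HolderConjugate.two_two (by simpa using hd) (by simpa using hg)
  simp only [Real.norm_eq_abs, Real.rpow_two, sq_abs, ← Real.sqrt_eq_rpow, Pi.sub_apply] at hcs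
  have hdg : Integrable (fun y => |f y - g y| * |g y|) ν := hd.abs.integrable_mul hg.abs
  calc ∫ y, |f y ^ 2 - g y ^ 2| ∂ν
      ≤ ∫ y, ((f y - g y) ^ 2 + 2 * (|f y - g y| * |g y|)) ∂ν := by
        refine integral_mono (hf.integrable_sq.sub hg.integrable_sq).abs
          (hd.integrable_sq.add (hdg.const_mul 2)) fun y => ?_
        calc |f y ^ 2 - g y ^ 2| = |(f y - g y) ^ 2 + 2 * ((f y - g y) * g y)| := by ring_nf
          _ ≤ _ := by
            refine (abs_add_le _ _).trans_eq ?_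
            rw [abs_sq, abs_mul, abs_mul, abs_two]
    _ = ∫ y, (f y - g y) ^ 2 ∂ν + 2 * ∫ y, |f y - g y| * |g y| ∂ν := by
        rw [integral_add (by exact hd.integrable_sq) (hdg.const_mul 2), integral_const_mul]
    _ ≤ _ := by gcongr

namespace IsLocalAlternative

lemma tendsto_mul_integral_abs_sq_sub_sq (hρ : IsLocalAlternative F n μ ζ v ρ)
    (hζ : IsAsymptoticallyStandard F μ ζ) (hn : Tendsto n F atTop) :
    Tendsto (fun i => (n i : ℝ) * ∫ y, |(√(ρ i y) - 1) ^ 2 - (v / (2 * √(n i)) * ζ i y) ^ 2| ∂μ i)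
      F (𝓝 0) := by
  have herr := hρ.tendsto_mul_integral_quadraticMeanError_sq hζ hn
  have hlim := herr.add ((herr.sqrt.mul
    (hζ.tendsto_integral_sq.const_mul (v ^ 2 / 4)).sqrt).const_mul 2)
  rw [Real.sqrt_zero, zero_mul, mul_zero, add_zero] at hlim
  refine squeeze_zero' (Eventually.of_forall fun i => ?_) ?_ hlim
  · exact mul_nonneg (Nat.cast_nonneg _) (integral_nonneg fun _ => abs_nonneg _)
  · filter_upwards [hρ.integrable, hn.eventually_ge_atTop 1] with i h_int hni
    have hn0 : (n i : ℝ) ≠ 0 := by positivity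
    have hζ2 : MemLp (ζ i) 2 (μ i) := (hζ.memLp_four i).mono_exponent (by norm_num)
    have hbound := integral_abs_sq_sub_sq_le
      (memLp_sqrt_sub_one (hρ.measurable i) (hρ.nonneg i) h_int) (hζ2.const_mul (v / (2 * √(n i))))
    have hlinear : v ^ 2 / 4 * ∫ y, ζ i y ^ 2 ∂μ i
        = n i * ∫ y, (v / (2 * √(n i)) * ζ i y) ^ 2 ∂μ i := by
      simp only [mul_pow, div_pow]
      rw [integral_const_mul, Real.sq_sqrt (n i).cast_nonneg]
      field_simp
      ring
    refine (mul_le_mul_of_nonneg_left hbound (n i).cast_nonneg).trans_eq ?_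
    rw [hlinear, Real.sqrt_mul (n i).cast_nonneg, Real.sqrt_mul (n i).cast_nonneg]
    simp only [quadraticMeanError]
    linear_combination -2 * √(∫ y, (√(ρ i y) - 1 - v / (2 * √(n i)) * ζ i y) ^ 2 ∂μ i)
      * √(∫ y, (v / (2 * √(n i)) * ζ i y) ^ 2 ∂μ i) * Real.sq_sqrt (n i).cast_nonneg

lemma tendstoZeroInProb_sum_sqrt_sub_one_sq (hρ : IsLocalAlternative F n μ ζ v ρ)
    (hζ : IsAsymptoticallyStandard F μ ζ) (hn : Tendsto n F atTop) :
    TendstoZeroInProb (fun i => Measure.pi fun _ : Fin (n i) => μ i) F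
      fun i y => ∑ j, (√(ρ i (y j)) - 1) ^ 2 - v ^ 2 / 4 := by
  have hdiff := tendstoZeroInProb_sum_of_integral_abs (hρ.integrable.mono fun i h_int =>
      (memLp_sqrt_sub_one (hρ.measurable i) (hρ.nonneg i) h_int).integrable_sq.sub
      (((hζ.memLp_four i).mono_exponent (q := 4) (p := 2) (by norm_num)).const_mul
        (v / (2 * √(n i)))).integrable_sq) (hρ.tendsto_mul_integral_abs_sq_sub_sq hζ hn)
  refine (hdiff.add (hζ.tendstoZeroInProb_sum_linear_sq hn v)).mono
    (Eventually.of_forall fun i y => le_of_eq ?_)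
  simp only [Finset.sum_sub_distrib, Pi.sub_apply]
  ring_nf

lemma tendstoZeroInProb_sum_quadraticMeanError (hρ : IsLocalAlternative F n μ ζ v ρ)
    (hζ : IsAsymptoticallyStandard F μ ζ) (hn : Tendsto n F atTop) :
    TendstoZeroInProb (fun i => Measure.pi fun _ : Fin (n i) => μ i) F
      fun i y => ∑ j, quadraticMeanError (n i) v (ζ i) (ρ i) (y j) + v ^ 2 / 8 := by
  have hmem : ∀ᶠ i in F, MemLp (quadraticMeanError (n i) v (ζ i) (ρ i)) 2 (μ i) :=
    hρ.integrable.mono fun i h_int => memLp_quadraticMeanError (hρ.measurable i) (hρ.nonneg i) h_int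
      ((hζ.memLp_four i).mono_exponent (by norm_num)) _ _
  have hcentred := tendstoZeroInProb_sum_sub_of_integral_sq hmem
    (hρ.tendsto_mul_integral_quadraticMeanError_sq hζ hn)
  have hmean := (hρ.tendsto_mul_integral_quadraticMeanError hζ hn).add_const (v ^ 2 / 8)
  rw [neg_add_cancel] at hmean
  refine (hcentred.add (.of_tendsto hmean)).mono (Eventually.of_forall fun i y => le_of_eq ?_)
  ring_nf

end IsLocalAlternative

lemma norm_pow_four_le {κ : Type*} [Fintype κ] (z w : κ → ℝ) :
    ‖z‖ ^ 4 ≤ 8 * (∑ j, (z j - w j) ^ 2) ^ 2 + 8 * ∑ j, w j ^ 4 := by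
  obtain _ | _ := isEmpty_or_nonempty κ
  · simp [Subsingleton.elim z 0]
  obtain ⟨j, -, hj⟩ := Finset.exists_mem_eq_sup' Finset.univ_nonempty fun j => ‖z j‖₊
  replace hj : ‖z j‖ = ‖z‖ := by
    rw [Pi.norm_def, ← Finset.sup'_eq_sup Finset.univ_nonempty, hj, coe_nnnorm]
  have hd : (z j - w j) ^ 2 ≤ ∑ j, (z j - w j) ^ 2 :=
    Finset.single_le_sum (f := fun j => (z j - w j) ^ 2) (fun _ _ => sq_nonneg _)
      (Finset.mem_univ j)
  have hw : w j ^ 4 ≤ ∑ j, w j ^ 4 :=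
    Finset.single_le_sum (f := fun j => w j ^ 4) (fun _ _ => by positivity) (Finset.mem_univ j)
  have hpow : z j ^ 4 ≤ 8 * ((z j - w j) ^ 2) ^ 2 + 8 * w j ^ 4 := by
    have hsq : z j ^ 2 ≤ 2 * (z j - w j) ^ 2 + 2 * w j ^ 2 := by
      nlinarith [sq_nonneg (z j - 2 * w j)]
    nlinarith [pow_le_pow_left₀ (sq_nonneg _) hsq 2, sq_nonneg ((z j - w j) ^ 2 - w j ^ 2)]
  rw [← hj, Real.norm_eq_abs, Even.pow_abs (by decide : Even 4)]
  nlinarith [pow_le_pow_left₀ (sq_nonneg _) hd 2]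

namespace IsLocalAlternative

lemma tendstoZeroInProb_norm_sqrt_sub_one (hρ : IsLocalAlternative F n μ ζ v ρ)
    (hζ : IsAsymptoticallyStandard F μ ζ) (hn : Tendsto n F atTop) :
    TendstoZeroInProb (fun i => Measure.pi fun _ : Fin (n i) => μ i) F
      fun i y => ‖fun j => √(ρ i (y j)) - 1‖ := by
  have hmem : ∀ᶠ i in F, MemLp (quadraticMeanError (n i) v (ζ i) (ρ i)) 2 (μ i) :=
    hρ.integrable.mono fun i h_int => memLp_quadraticMeanError (hρ.measurable i) (hρ.nonneg i) h_int
      ((hζ.memLp_four i).mono_exponent (by norm_num)) _ _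
  have herr := tendstoZeroInProb_sum_of_integral_abs (hmem.mono fun i hi => hi.integrable_sq)
    (by simpa only [abs_sq] using hρ.tendsto_mul_integral_quadraticMeanError_sq hζ hn)
  have habs (x : ℝ) : |x ^ 4| = x ^ 4 := abs_of_nonneg (by positivity)
  have hlinear := tendstoZeroInProb_sum_of_integral_abs (Eventually.of_forall fun i =>
      integrable_pow_of_memLp_four ((hζ.memLp_four i).const_mul (v / (2 * √(n i)))) le_rfl)
    (by simpa only [habs] using hζ.tendsto_mul_integral_linear_pow_four hn v)
  refine .of_pow (m := 4) ((((herr.mul_of_sub_const (c := 0) (by simpa using herr)).const_mul 8).add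
    (hlinear.const_mul 8)).mono (Eventually.of_forall fun i y => ?_))
  rw [abs_of_nonneg (by positivity)]
  refine (norm_pow_four_le _ fun j => v / (2 * √(n i)) * ζ i (y j)).trans
    ((le_abs_self _).trans_eq ?_)
  simp only [quadraticMeanError, pow_two]

lemma tendstoZeroInProb_sum_log_sub (hρ : IsLocalAlternative F n μ ζ v ρ)
    (hζ : IsAsymptoticallyStandard F μ ζ) (hn : Tendsto n F atTop) :
    TendstoZeroInProb (fun i => Measure.pi fun _ : Fin (n i) => μ i) F
      fun i y => ∑ j, (Real.log (ρ i (y j)) - 2 * (√(ρ i (y j)) - 1) + (√(ρ i (y j)) - 1) ^ 2) := by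
  have hmax := hρ.tendstoZeroInProb_norm_sqrt_sub_one hζ hn
  refine hmax.of_abs_le_imp ((hmax.const_mul 4).mul_of_sub_const
    (hρ.tendstoZeroInProb_sum_sqrt_sub_one_sq hζ hn)) (Eventually.of_forall fun i y hy => ?_)
  set z : Fin (n i) → ℝ := fun j => √(ρ i (y j)) - 1
  rw [abs_norm] at hy
  have hz (j : Fin (n i)) : |z j| ≤ ‖z‖ := norm_le_pi_norm z j
  calc _ ≤ ∑ j, |Real.log (ρ i (y j)) - 2 * z j + z j ^ 2| := Finset.abs_sum_le_sum_abs _ _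
    _ ≤ ∑ j, 4 * ‖z‖ * z j ^ 2 := by
      gcongr with j
      refine (abs_log_sub_two_mul_add_sq_le (hρ.nonneg i _) ((hz j).trans hy)).trans ?_
      gcongr
      exact hz j
    _ ≤ _ := by rw [← Finset.mul_sum]; exact le_abs_self _

theorem tendstoZeroInProb_sum_log (hρ : IsLocalAlternative F n μ ζ v ρ)
    (hζ : IsAsymptoticallyStandard F μ ζ) (hn : Tendsto n F atTop) :
    TendstoZeroInProb (fun i => Measure.pi fun _ : Fin (n i) => μ i) F
      fun i y => ∑ j, Real.log (ρ i (y j)) - v * normalizedSum (n i) (ζ i) y + v ^ 2 / 2 := by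
  refine ((((hρ.tendstoZeroInProb_sum_quadraticMeanError hζ hn).const_mul 2).sub
    (hρ.tendstoZeroInProb_sum_sqrt_sub_one_sq hζ hn)).add
    (hρ.tendstoZeroInProb_sum_log_sub hζ hn)).mono (Eventually.of_forall fun i y => le_of_eq ?_)
  simp only [quadraticMeanError, normalizedSum, Finset.sum_add_distrib, Finset.sum_sub_distrib,
    ← Finset.mul_sum]
  congr 1
  ring

end IsLocalAlternative

end LocalAsymptoticNormality

section RandomWalk

/-- The transition operator of the simple symmetric random walk on `ℤ`. It is self-adjoint, so that
it describes both the evolution of the law of the walk and that of conditional expectations. -/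
noncomputable def walkStep (f : ℤ → ℝ) (y : ℤ) : ℝ := (f (y - 1) + f (y + 1)) / 2

/-- The generator, i.e. the discrete Laplacian, of the continuous-time simple symmetric random walk
on `ℤ` that jumps at rate `1`. -/
noncomputable def walkGenerator (f : ℤ → ℝ) (y : ℤ) : ℝ := walkStep f y - f y

/-- The probability that the simple symmetric random walk is at a given site after `a` steps. -/
noncomputable def walkProb (a : ℕ) : ℤ → ℝ := walkStep^[a] (Pi.single 0 1)

lemma walkProb_zero : walkProb 0 = Pi.single 0 1 := rfl

lemma walkProb_succ (a : ℕ) : walkProb (a + 1) = walkStep (walkProb a) :=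
  Function.iterate_succ_apply' _ _ _

lemma hasSum_walkStep_mul_sub {f g h : ℤ → ℝ}
    (hfg : ∀ y, HasSum (fun z => f z * g (y - z)) (h y)) (y : ℤ) :
    HasSum (fun z => walkStep f z * g (y - z)) (walkStep h y) := by
  have hleft : HasSum (fun z => f (z - 1) * g (y - z)) (h (y - 1)) := by
    rw [← (Equiv.addRight (1 : ℤ)).hasSum_iff]
    simpa [Function.comp_def, sub_sub, add_comm] using hfg (y - 1)
  have hright : HasSum (fun z => f (z + 1) * g (y - z)) (h (y + 1)) := by
    rw [← (Equiv.subRight (1 : ℤ)).hasSum_iff]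
    simpa [Function.comp_def, sub_add, add_sub_assoc, sub_sub_eq_add_sub] using hfg (y + 1)
  convert! (hleft.add hright).div_const 2 using 2 with z
  rw [walkStep]
  ring

lemma hasSum_walkProb_mul_sub (a : ℕ) (g : ℤ → ℝ) (y : ℤ) :
    HasSum (fun z => walkProb a z * g (y - z)) (walkStep^[a] g y) := by
  induction a generalizing y with
  | zero =>
    convert! hasSum_ite_eq (0 : ℤ) (g y) using 2 with z
    by_cases hz : z = 0 <;> simp [walkProb_zero, hz]
  | succ a ih =>
    rw [walkProb_succ, Function.iterate_succ_apply']
    exact hasSum_walkStep_mul_sub ih y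

lemma iterate_walkStep_one (a : ℕ) : walkStep^[a] (fun _ => 1) = fun _ => 1 :=
  Function.iterate_fixed (by ext; norm_num [walkStep]) a

lemma iterate_walkStep_sq (a : ℕ) :
    walkStep^[a] (fun y => (y : ℝ) ^ 2) = fun y : ℤ => (y : ℝ) ^ 2 + a := by
  induction a with
  | zero => simp
  | succ a ih =>
    rw [Function.iterate_succ_apply', ih]
    ext y
    simp only [walkStep]
    push_cast
    ring

lemma iterate_walkStep_pow_four (a : ℕ) : walkStep^[a] (fun y => (y : ℝ) ^ 4)
    = fun y : ℤ => (y : ℝ) ^ 4 + 6 * a * (y : ℝ) ^ 2 + 3 * a ^ 2 - 2 * a := by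
  induction a with
  | zero => simp
  | succ a ih =>
    rw [Function.iterate_succ_apply', ih]
    ext y
    simp only [walkStep]
    push_cast
    ring

lemma iterate_walkStep_cosh (s : ℝ) (a : ℕ) : walkStep^[a] (fun y => Real.cosh (s * y))
    = fun y : ℤ => Real.cosh s ^ a * Real.cosh (s * y) := by
  induction a with
  | zero => simp
  | succ a ih =>
    rw [Function.iterate_succ_apply', ih]
    ext y
    simp only [walkStep]
    push_cast
    rw [mul_add, mul_sub, mul_one, Real.cosh_add, Real.cosh_sub]
    ring

lemma iterate_walkStep_nonneg {g : ℤ → ℝ} (hg : ∀ y, 0 ≤ g y) (a : ℕ) (y : ℤ) :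
    0 ≤ walkStep^[a] g y := by
  induction a generalizing y with
  | zero => exact hg y
  | succ a ih =>
    rw [Function.iterate_succ_apply', walkStep]
    linarith [ih (y - 1), ih (y + 1)]

lemma walkProb_nonneg (a : ℕ) (y : ℤ) : 0 ≤ walkProb a y :=
  iterate_walkStep_nonneg (fun z => by by_cases hz : z = 0 <;> simp [hz]) a y

lemma hasSum_walkProb (a : ℕ) : HasSum (walkProb a) 1 := by
  simpa [iterate_walkStep_one] using hasSum_walkProb_mul_sub a (fun _ => 1) 0

lemma walkProb_le_one (a : ℕ) (y : ℤ) : walkProb a y ≤ 1 :=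
  le_hasSum (hasSum_walkProb a) y fun z _ => walkProb_nonneg a z

lemma walkProb_natAbs_pos (y : ℤ) : 0 < walkProb y.natAbs y := by
  suffices h : ∀ (a : ℕ) (y : ℤ), y.natAbs = a → 0 < walkProb a y from h _ y rfl
  intro a
  induction a with
  | zero => intro y hy; simp [walkProb_zero, Int.natAbs_eq_zero.1 hy]
  | succ a ih =>
    intro y hy
    rw [walkProb_succ, walkStep]
    rcases lt_or_ge 0 y with hpos | hneg
    · linarith [ih (y - 1) (by omega), walkProb_nonneg a (y + 1)]
    · linarith [ih (y + 1) (by omega), walkProb_nonneg a (y - 1)]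

lemma mul_walkProb_succ (a : ℕ) (y : ℤ) :
    y * walkProb (a + 1) y = (a + 1) / 2 * (walkProb a (y - 1) - walkProb a (y + 1)) := by
  induction a generalizing y with
  | zero =>
    rcases eq_or_ne y 1 with rfl | h1
    · norm_num [walkProb_succ, walkProb_zero, walkStep]
    rcases eq_or_ne y (-1) with rfl | h2
    · norm_num [walkProb_succ, walkProb_zero, walkStep]
    simp [walkProb_succ, walkProb_zero, walkStep, sub_eq_zero, h1,
      add_eq_zero_iff_eq_neg, h2]
  | succ a ih =>
    have hstep := ih (y - 1)
    have hstep' := ih (y + 1)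
    simp only [walkProb_succ (a + 1), walkStep]
    push_cast at hstep hstep' ⊢
    rw [sub_add_cancel] at hstep
    rw [add_sub_cancel_right] at hstep'
    have hdiff : walkProb (a + 1) (y - 1) - walkProb (a + 1) (y + 1)
        = (walkProb a (y - 1 - 1) - walkProb a (y + 1 + 1)) / 2 := by
      simp only [walkProb_succ, walkStep, sub_add_cancel, add_sub_cancel_right]
      ring
    linear_combination hstep / 2 + hstep' / 2 - (a + 1) / 2 * hdiff

end RandomWalk

section PoissonWeights

/-- The weight `e⁻ˡ lᵃ / a!` of the Poisson distribution, for a real parameter `l` in order that it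
can be differentiated. -/
noncomputable def poissonWeight (l : ℝ) (a : ℕ) : ℝ := Real.exp (-l) * l ^ a / a.factorial

lemma poissonWeight_pos {l : ℝ} (hl : 0 < l) (a : ℕ) : 0 < poissonWeight l a := by
  unfold poissonWeight; positivity

lemma poissonWeight_nonneg {l : ℝ} (hl : 0 ≤ l) (a : ℕ) : 0 ≤ poissonWeight l a := by
  unfold poissonWeight; positivity

lemma hasSum_poissonWeight_mul_pow (l c : ℝ) :
    HasSum (fun a => poissonWeight l a * c ^ a) (Real.exp (l * (c - 1))) := by
  have h := (NormedSpace.expSeries_div_hasSum_exp (l * c)).mul_left (Real.exp (-l))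
  rw [← Real.exp_eq_exp_ℝ, ← Real.exp_add] at h
  convert! h using 1
  · ext a; simp only [poissonWeight, mul_pow]; ring
  · congr 1; ring

lemma hasSum_poissonWeight (l : ℝ) : HasSum (poissonWeight l) 1 := by
  simpa using hasSum_poissonWeight_mul_pow l 1

lemma poissonWeight_succ_mul (l : ℝ) (a : ℕ) :
    poissonWeight l (a + 1) * (a + 1) = l * poissonWeight l a := by
  unfold poissonWeight
  rw [Nat.factorial_succ]
  have : (a.factorial : ℝ) ≠ 0 := by positivity
  push_cast
  field_simp
  ring

lemma hasSum_poissonWeight_mul_natCast_mul {l S : ℝ} {c : ℕ → ℝ}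
    (hc : HasSum (fun a => poissonWeight l a * c (a + 1)) S) :
    HasSum (fun a => poissonWeight l a * (a * c a)) (l * S) := by
  rw [← hasSum_nat_add_iff' 1]
  convert! hc.mul_left l using 1
  · ext a
    push_cast
    linear_combination c (a + 1) * poissonWeight_succ_mul l a
  · simp

lemma hasSum_poissonWeight_mul_natCast (l : ℝ) : HasSum (fun a => poissonWeight l a * a) l := by
  have h := hasSum_poissonWeight_mul_natCast_mul (c := fun _ => 1)
    (by simpa using hasSum_poissonWeight l)
  simpa only [mul_one] using h

lemma hasSum_poissonWeight_mul_natCast_sq (l : ℝ) :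
    HasSum (fun a => poissonWeight l a * (a : ℝ) ^ 2) (l ^ 2 + l) := by
  convert! hasSum_poissonWeight_mul_natCast_mul (c := fun a => (a : ℝ))
    (by simpa [mul_add] using (hasSum_poissonWeight_mul_natCast l).add (hasSum_poissonWeight l))
    using 1
  · ext a; ring
  · ring

lemma hasSum_poissonWeight_mul_div_sub_one_sq {l : ℝ} (hl : l ≠ 0) :
    HasSum (fun a => poissonWeight l a * (a / l - 1) ^ 2) (1 / l) := by
  convert! (((hasSum_poissonWeight_mul_natCast_sq l).div_const (l ^ 2)).sub
    ((hasSum_poissonWeight_mul_natCast l).mul_left (2 / l))).add (hasSum_poissonWeight l) using 1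
  · ext a; field_simp; ring
  · field_simp; ring

lemma sum_antidiagonal_poissonWeight_mul (l m : ℝ) (c : ℕ) :
    ∑ ab ∈ Finset.HasAntidiagonal.antidiagonal c, poissonWeight l ab.1 * poissonWeight m ab.2
      = poissonWeight (l + m) c := by
  rw [poissonWeight, neg_add, Real.exp_add, (Commute.all l m).add_pow', mul_div_assoc,
    Finset.sum_div, Finset.mul_sum]
  refine Finset.sum_congr rfl fun ab hab => ?_
  obtain rfl := Finset.HasAntidiagonal.mem_antidiagonal.1 hab
  have hchoose := Nat.add_choose_mul_factorial_mul_factorial ab.1 ab.2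
  rw [← Nat.choose_symm_add] at hchoose
  have hpos := Nat.choose_pos (Nat.le_add_right ab.1 ab.2)
  rw [nsmul_eq_mul, poissonWeight, poissonWeight, ← hchoose]
  push_cast
  field_simp

lemma summable_pow_div_factorial_mul {c : ℕ → ℝ} (hc : ∀ a, |c a| ≤ 1) (l : ℝ) :
    Summable fun a => l ^ a / a.factorial * c a := by
  refine .of_norm_bounded (Real.summable_pow_div_factorial l).norm fun a => ?_
  rw [norm_mul]
  exact mul_le_of_le_one_right (norm_nonneg _) (hc a)

lemma tsum_poissonWeight_mul (c : ℕ → ℝ) (l : ℝ) :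
    ∑' a, poissonWeight l a * c a = Real.exp (-l) * ∑' a, l ^ a / a.factorial * c a := by
  simp only [poissonWeight, mul_div_assoc, mul_assoc, tsum_mul_left]

lemma summable_poissonWeight_mul {c : ℕ → ℝ} (hc : ∀ a, |c a| ≤ 1) (l : ℝ) :
    Summable fun a => poissonWeight l a * c a := by
  simpa only [poissonWeight, mul_div_assoc, mul_assoc] using
    (summable_pow_div_factorial_mul hc l).mul_left (Real.exp (-l))

lemma natCast_succ_mul_pow_div_factorial_succ (a : ℕ) (x : ℝ) :
    ((a + 1 : ℕ) : ℝ) * x ^ (a + 1 - 1) / (a + 1).factorial = x ^ a / a.factorial := by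
  rw [Nat.factorial_succ, add_tsub_cancel_right]
  push_cast
  field_simp

lemma hasDerivAt_tsum_pow_div_factorial_mul {c : ℕ → ℝ} (hc : ∀ a, |c a| ≤ 1) (l : ℝ) :
    HasDerivAt (fun l => ∑' a, l ^ a / a.factorial * c a)
      (∑' a, l ^ a / a.factorial * c (a + 1)) l := by
  have hbound : Summable fun a : ℕ => a * (|l| + 1) ^ (a - 1) / a.factorial :=
    (summable_nat_add_iff 1).1 ((Real.summable_pow_div_factorial (|l| + 1)).congr fun a =>
      (natCast_succ_mul_pow_div_factorial_succ a _).symm)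
  have hderiv : HasSum (fun a : ℕ => a * l ^ (a - 1) / a.factorial * c a)
      (∑' a, l ^ a / a.factorial * c (a + 1)) := by
    refine (hasSum_nat_add_iff' 1).1 ?_
    simpa only [natCast_succ_mul_pow_div_factorial_succ, Finset.sum_range_one, Nat.cast_zero,
      zero_mul, zero_div, sub_zero] using
      (summable_pow_div_factorial_mul (fun a => hc (a + 1)) l).hasSum
  rw [← hderiv.tsum_eq]
  refine hasDerivAt_tsum_of_isPreconnected hbound Metric.isOpen_ball
    (convex_ball (0 : ℝ) (|l| + 1)).isPreconnected
    (fun a x _ => ((hasDerivAt_pow a x).div_const _).mul_const _) (fun a x hx => ?_)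
    (y₀ := l) (by simp) (summable_pow_div_factorial_mul hc l) (by simp)
  rw [mem_ball_zero_iff, Real.norm_eq_abs] at hx
  rw [norm_mul, norm_div, norm_mul, norm_pow, Real.norm_natCast, Real.norm_natCast,
    Real.norm_eq_abs, Real.norm_eq_abs]
  refine (mul_le_of_le_one_right (by positivity) (hc a)).trans ?_
  gcongr

lemma hasDerivAt_tsum_poissonWeight_mul {c : ℕ → ℝ} (hc : ∀ a, |c a| ≤ 1) (l : ℝ) :
    HasDerivAt (fun l => ∑' a, poissonWeight l a * c a)
      (∑' a, poissonWeight l a * c (a + 1) - ∑' a, poissonWeight l a * c a) l := by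
  simp only [tsum_poissonWeight_mul]
  refine ((hasDerivAt_neg l).exp.mul (hasDerivAt_tsum_pow_div_factorial_mul hc l)).congr_deriv ?_
  ring

end PoissonWeights

section SkellamDistribution

/-- The symmetric Skellam distribution of mean jump number `l`: the law at time `l` of the
continuous-time simple symmetric random walk on `ℤ` that jumps at rate `1`. It is the law of an
increment of the compound Poisson process over an interval in which `l` jumps are expected. -/
noncomputable def skellamProb (l : ℝ) (y : ℤ) : ℝ := ∑' a, poissonWeight l a * walkProb a y

lemma abs_walkProb_le_one (a : ℕ) (y : ℤ) : |walkProb a y| ≤ 1 := by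
  rw [abs_of_nonneg (walkProb_nonneg a y)]
  exact walkProb_le_one a y

lemma hasSum_skellamProb (l : ℝ) (y : ℤ) :
    HasSum (fun a => poissonWeight l a * walkProb a y) (skellamProb l y) :=
  (summable_poissonWeight_mul (fun a => abs_walkProb_le_one a y) l).hasSum

lemma skellamProb_nonneg {l : ℝ} (hl : 0 ≤ l) (y : ℤ) : 0 ≤ skellamProb l y :=
  tsum_nonneg fun a => mul_nonneg (poissonWeight_nonneg hl a) (walkProb_nonneg a y)

lemma skellamProb_pos {l : ℝ} (hl : 0 < l) (y : ℤ) : 0 < skellamProb l y :=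
  (hasSum_skellamProb l y).summable.tsum_pos
    (fun a => mul_nonneg (poissonWeight_nonneg hl.le a) (walkProb_nonneg a y)) y.natAbs
    (mul_pos (poissonWeight_pos hl _) (walkProb_natAbs_pos y))

lemma hasSum_iterate_walkStep_skellamProb (l : ℝ) (b : ℕ) (y : ℤ) :
    HasSum (fun a => poissonWeight l a * walkProb (a + b) y) (walkStep^[b] (skellamProb l) y) := by
  induction b generalizing y with
  | zero => exact hasSum_skellamProb l y
  | succ b ih =>
    rw [Function.iterate_succ_apply', walkStep]
    convert! ((ih (y - 1)).add (ih (y + 1))).div_const 2 using 2 with a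
    rw [← add_assoc, walkProb_succ, walkStep]
    ring

lemma hasDerivAt_skellamProb (l : ℝ) (y : ℤ) :
    HasDerivAt (fun l => skellamProb l y) (walkGenerator (skellamProb l) y) l := by
  have h := hasDerivAt_tsum_poissonWeight_mul (fun a => abs_walkProb_le_one a y) l
  rwa [(hasSum_iterate_walkStep_skellamProb l 1 y).tsum_eq] at h

lemma hasSum_walkGenerator_skellamProb {l : ℝ} (hl : l ≠ 0) (y : ℤ) :
    HasSum (fun a => poissonWeight l a * walkProb a y * (a / l - 1))
      (walkGenerator (skellamProb l) y) := by
  have hscaled := (hasSum_poissonWeight_mul_natCast_mul (c := fun a => walkProb a y)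
    (hasSum_iterate_walkStep_skellamProb l 1 y)).div_const l
  rw [mul_div_cancel_left₀ _ hl] at hscaled
  convert! hscaled.sub (hasSum_skellamProb l y) using 2 with a
  ring

lemma mul_skellamProb (l : ℝ) (y : ℤ) :
    y * skellamProb l y = l / 2 * (skellamProb l (y - 1) - skellamProb l (y + 1)) := by
  have hwalk (a : ℕ) : (a : ℝ) * (y * walkProb a y / a) = y * walkProb a y := by
    rcases eq_or_ne a 0 with rfl | ha
    · by_cases hy : y = 0 <;> simp [walkProb_zero, hy]
    · field_simp
  have hdiff : HasSum (fun a => poissonWeight l a * (y * walkProb (a + 1) y / (a + 1 : ℕ)))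
      ((skellamProb l (y - 1) - skellamProb l (y + 1)) / 2) := by
    convert! ((hasSum_skellamProb l (y - 1)).sub (hasSum_skellamProb l (y + 1))).div_const 2 using 2
      with a
    rw [mul_walkProb_succ]
    push_cast
    field_simp
  have hsum := hasSum_poissonWeight_mul_natCast_mul
    (c := fun a => y * walkProb a y / (a : ℝ)) hdiff
  simp only [hwalk, mul_left_comm _ (y : ℝ)] at hsum
  rw [((hasSum_skellamProb l y).mul_left (y : ℝ)).unique hsum]
  ring

/-- Stein's identity `mul_skellamProb`, applied twice. -/
lemma walkGenerator_skellamProb_eq {l : ℝ} (hl : l ≠ 0) (y : ℤ) :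
    (2 * l + 1) * walkGenerator (skellamProb l) y
      = (y ^ 2 / l - 1) * skellamProb l y
        - l * walkGenerator (walkGenerator (skellamProb l)) y := by
  have h0 := mul_skellamProb l y
  have h1 := mul_skellamProb l (y - 1)
  have h2 := mul_skellamProb l (y + 1)
  push_cast at h1 h2
  rw [sub_add_cancel] at h1
  rw [add_sub_cancel_right] at h2
  simp only [walkGenerator, walkStep, sub_add_cancel, add_sub_cancel_right]
  field_simp
  linear_combination -4 * (y * h0 + l / 2 * h1 - l / 2 * h2)

lemma hasSum_comm_of_nonneg {α β : Type*} {f : α → β → ℝ} {r : α → ℝ} {c : β → ℝ} {S : ℝ}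
    (hf : ∀ a b, 0 ≤ f a b) (hrow : ∀ a, HasSum (f a) (r a)) (hr : HasSum r S)
    (hcol : ∀ b, HasSum (fun a => f a b) (c b)) : HasSum c S := by
  have hsummable : Summable fun p : α × β => f p.1 p.2 := by
    refine (summable_prod_of_nonneg fun p => hf p.1 p.2).2 ⟨fun a => (hrow a).summable, ?_⟩
    simpa only [(hrow _).tsum_eq] using hr.summable
  have htotal : HasSum (fun p : α × β => f p.1 p.2) S := by
    rw [← (hsummable.hasSum.prod_fiberwise hrow).unique hr]
    exact hsummable.hasSum
  exact ((Equiv.prodComm β α).hasSum_iff.2 htotal).prod_fiberwise hcol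

lemma hasSum_skellamProb_mul_sub {l : ℝ} (hl : 0 ≤ l) {g : ℤ → ℝ} (hg : ∀ z, 0 ≤ g z) {y : ℤ}
    {S : ℝ} (hS : HasSum (fun a => poissonWeight l a * walkStep^[a] g y) S) :
    HasSum (fun z => skellamProb l z * g (y - z)) S := by
  refine hasSum_comm_of_nonneg (f := fun a z => poissonWeight l a * (walkProb a z * g (y - z)))
    (fun a z => ?_) (fun a => (hasSum_walkProb_mul_sub a g y).mul_left _) hS fun z => ?_
  · exact mul_nonneg (poissonWeight_nonneg hl a) (mul_nonneg (walkProb_nonneg a z) (hg _))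
  · simpa only [mul_assoc] using (hasSum_skellamProb l z).mul_right (g (y - z))

lemma hasSum_skellamProb_one {l : ℝ} (hl : 0 ≤ l) : HasSum (skellamProb l) 1 := by
  simpa using hasSum_skellamProb_mul_sub hl (g := fun _ => 1) (y := 0) (S := 1)
    (fun _ => zero_le_one) (by simpa [iterate_walkStep_one] using hasSum_poissonWeight l)

lemma hasSum_skellamProb_mul_sq {l : ℝ} (hl : 0 ≤ l) :
    HasSum (fun y => skellamProb l y * (y : ℝ) ^ 2) l := by
  simpa using hasSum_skellamProb_mul_sub hl (g := fun y => (y : ℝ) ^ 2) (y := 0)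
    (fun _ => sq_nonneg _) (by simpa [iterate_walkStep_sq] using hasSum_poissonWeight_mul_natCast l)

lemma hasSum_skellamProb_mul_pow_four {l : ℝ} (hl : 0 ≤ l) :
    HasSum (fun y => skellamProb l y * (y : ℝ) ^ 4) (3 * l ^ 2 + l) := by
  have hS : HasSum (fun a => poissonWeight l a * walkStep^[a] (fun y => (y : ℝ) ^ 4) 0)
      (3 * l ^ 2 + l) := by
    convert! ((hasSum_poissonWeight_mul_natCast_sq l).mul_left 3).sub
      ((hasSum_poissonWeight_mul_natCast l).mul_left 2) using 1
    · ext a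
      simp only [iterate_walkStep_pow_four, Int.cast_zero]
      ring
    · ring
  have h := hasSum_skellamProb_mul_sub hl (fun y => by positivity) hS
  simpa [Even.neg_pow (by decide : Even 4)] using h

lemma hasSum_skellamProb_mul_cosh {l : ℝ} (hl : 0 ≤ l) (s : ℝ) :
    HasSum (fun y => skellamProb l y * Real.cosh (s * y)) (Real.exp (l * (Real.cosh s - 1))) := by
  simpa using hasSum_skellamProb_mul_sub hl (g := fun y => Real.cosh (s * y)) (y := 0)
    (fun _ => (Real.cosh_pos _).le)
    (by simpa [iterate_walkStep_cosh] using hasSum_poissonWeight_mul_pow l (Real.cosh s))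

lemma hasSum_skellamProb_mul_skellamProb_sub {l m : ℝ} (hl : 0 ≤ l) (hm : 0 ≤ m) (y : ℤ) :
    HasSum (fun z => skellamProb l z * skellamProb m (y - z)) (skellamProb (l + m) y) := by
  refine hasSum_skellamProb_mul_sub hl (skellamProb_nonneg hm) ?_
  have hsummable : Summable fun p : ℕ × ℕ =>
      poissonWeight l p.1 * poissonWeight m p.2 * walkProb (p.1 + p.2) y := by
    refine .of_nonneg_of_le (fun p => ?_) (fun p => ?_)
      ((hasSum_poissonWeight l).summable.mul_of_nonneg (hasSum_poissonWeight m).summable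
        (poissonWeight_nonneg hl) (poissonWeight_nonneg hm))
    · exact mul_nonneg (mul_nonneg (poissonWeight_nonneg hl _) (poissonWeight_nonneg hm _))
        (walkProb_nonneg _ _)
    · exact mul_le_of_le_one_right
        (mul_nonneg (poissonWeight_nonneg hl _) (poissonWeight_nonneg hm _)) (walkProb_le_one _ _)
  have hdiag : HasSum (fun c => poissonWeight (l + m) c * walkProb c y)
      (∑' p : ℕ × ℕ, poissonWeight l p.1 * poissonWeight m p.2 * walkProb (p.1 + p.2) y) := by
    convert! ((Finset.HasAntidiagonal.sigmaAntidiagonalEquivProd.hasSum_iff.2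
      hsummable.hasSum).sigma fun c => hasSum_fintype _) using 2 with c
    rw [← sum_antidiagonal_poissonWeight_mul, Finset.sum_mul, ← Finset.sum_attach]
    refine Finset.sum_congr rfl fun p _ => ?_
    exact congrArg (_ * walkProb · y) (Finset.HasAntidiagonal.mem_antidiagonal.1 p.2).symm
  rw [skellamProb, hdiag.tsum_eq]
  refine hsummable.hasSum.prod_fiberwise fun a => ?_
  simpa only [mul_assoc, add_comm a] using
    (hasSum_iterate_walkStep_skellamProb m a y).mul_left (poissonWeight l a)

lemma hasSum_walkGenerator_mul_sub {f g h : ℤ → ℝ}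
    (hfg : ∀ y, HasSum (fun z => f z * g (y - z)) (h y)) (y : ℤ) :
    HasSum (fun z => walkGenerator f z * g (y - z)) (walkGenerator h y) := by
  simpa only [walkGenerator, sub_mul] using (hasSum_walkStep_mul_sub hfg y).sub (hfg y)

lemma hasSum_walkGenerator_mul_walkGenerator_sub {f g h : ℤ → ℝ}
    (hfg : ∀ y, HasSum (fun z => f z * g (y - z)) (h y)) (y : ℤ) :
    HasSum (fun z => walkGenerator f z * walkGenerator g (y - z))
      (walkGenerator (walkGenerator h) y) := by
  have hswap {u v w : ℤ → ℝ} (huv : ∀ y, HasSum (fun z => u z * v (y - z)) (w y)) (y : ℤ) :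
      HasSum (fun z => v z * u (y - z)) (w y) := by
    rw [← (Equiv.subLeft y).hasSum_iff]
    simpa [Function.comp_def, mul_comm] using huv y
  exact hswap (hasSum_walkGenerator_mul_sub (hswap (hasSum_walkGenerator_mul_sub hfg))) y

end SkellamDistribution

section FisherInformation

/-- Cauchy–Schwarz: a mixture carries at most the mean information of its components. -/
lemma sum_sq_div_le_of_hasSum {α β : Type*} (s : Finset β) {k φ : β → α → ℝ} {q f : β → ℝ}
    {T : α → ℝ} {S : ℝ} (hk : ∀ b a, 0 ≤ k b a) (hq : ∀ b, 0 < q b)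
    (h0 : ∀ b, HasSum (k b) (q b)) (h1 : ∀ b, HasSum (fun a => k b a * φ b a) (f b))
    (hT : ∀ a, ∑ b ∈ s, k b a * φ b a ^ 2 ≤ T a) (hS : HasSum T S) :
    ∑ b ∈ s, f b ^ 2 / q b ≤ S := by
  have hterm (b a) : 0 ≤ k b a * φ b a ^ 2 := mul_nonneg (hk b a) (sq_nonneg _)
  have hsummable (b) (hb : b ∈ s) : Summable fun a => k b a * φ b a ^ 2 :=
    .of_nonneg_of_le (hterm b) (fun a => (Finset.single_le_sum (fun b _ => hterm b a) hb).trans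
      (hT a)) hS.summable
  have hcauchy (b) (hb : b ∈ s) : f b ^ 2 / q b ≤ ∑' a, k b a * φ b a ^ 2 := by
    have hsq := ((hsummable b hb).hasSum.sub ((h1 b).mul_left (2 * (f b / q b)))).add
      ((h0 b).mul_left ((f b / q b) ^ 2))
    have hnonneg := hsq.nonneg fun a => by
      rw [show k b a * φ b a ^ 2 - 2 * (f b / q b) * (k b a * φ b a) + (f b / q b) ^ 2 * k b a
        = k b a * (φ b a - f b / q b) ^ 2 by ring]
      exact mul_nonneg (hk b a) (sq_nonneg _)
    have hqb := (hq b).ne'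
    have : 2 * (f b / q b) * f b - (f b / q b) ^ 2 * q b = f b ^ 2 / q b := by field_simp; ring
    linarith
  calc ∑ b ∈ s, f b ^ 2 / q b ≤ ∑ b ∈ s, ∑' a, k b a * φ b a ^ 2 := Finset.sum_le_sum hcauchy
    _ ≤ S := hasSum_le hT (hasSum_sum fun b hb => (hsummable b hb).hasSum) hS

/-- The Fisher information of the family `skellamProb` at `l`; its score is
`walkGenerator (skellamProb l) / skellamProb l` by `hasDerivAt_skellamProb`. -/
noncomputable def fisherInfo (l : ℝ) : ℝ :=
  ∑' y, walkGenerator (skellamProb l) y ^ 2 / skellamProb l y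

variable {l : ℝ}

lemma sq_walkGenerator_skellamProb_div_nonneg (hl : 0 < l) (y : ℤ) :
    0 ≤ walkGenerator (skellamProb l) y ^ 2 / skellamProb l y :=
  div_nonneg (sq_nonneg _) (skellamProb_nonneg hl.le y)

lemma sum_sq_walkGenerator_skellamProb_div_le (hl : 0 < l) (s : Finset ℤ) :
    ∑ y ∈ s, walkGenerator (skellamProb l) y ^ 2 / skellamProb l y ≤ 1 / l := by
  refine sum_sq_div_le_of_hasSum s
    (fun y a => mul_nonneg (poissonWeight_nonneg hl.le a) (walkProb_nonneg a y))
    (skellamProb_pos hl) (hasSum_skellamProb l) (hasSum_walkGenerator_skellamProb hl.ne')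
    (fun a => ?_) (hasSum_poissonWeight_mul_div_sub_one_sq hl.ne')
  simp only [mul_right_comm _ (walkProb a _), ← Finset.mul_sum]
  exact mul_le_of_le_one_right (mul_nonneg (poissonWeight_nonneg hl.le a) (sq_nonneg _))
    (sum_le_hasSum s (fun y _ => walkProb_nonneg a y) (hasSum_walkProb a))

lemma hasSum_fisherInfo (hl : 0 < l) :
    HasSum (fun y => walkGenerator (skellamProb l) y ^ 2 / skellamProb l y) (fisherInfo l) :=
  (summable_of_sum_le (sq_walkGenerator_skellamProb_div_nonneg hl)
    (sum_sq_walkGenerator_skellamProb_div_le hl)).hasSum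

lemma fisherInfo_le_of_sum_le (hl : 0 < l) {B : ℝ}
    (hB : ∀ s : Finset ℤ, ∑ y ∈ s, walkGenerator (skellamProb l) y ^ 2 / skellamProb l y ≤ B) :
    fisherInfo l ≤ B :=
  Real.tsum_le_of_sum_le (sq_walkGenerator_skellamProb_div_nonneg hl) hB

lemma fisherInfo_nonneg (hl : 0 < l) : 0 ≤ fisherInfo l :=
  (hasSum_fisherInfo hl).nonneg (sq_walkGenerator_skellamProb_div_nonneg hl)

lemma fisherInfo_le_inv (hl : 0 < l) : fisherInfo l ≤ 1 / l :=
  fisherInfo_le_of_sum_le hl (sum_sq_walkGenerator_skellamProb_div_le hl)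

/-- Over two independent time spans of mean length `l / 2`, the second-order score is the product
of the first-order scores, averaged given the total displacement. -/
lemma sum_sq_walkGenerator_walkGenerator_skellamProb_div_le (hl : 0 < l) (s : Finset ℤ) :
    ∑ y ∈ s, walkGenerator (walkGenerator (skellamProb l)) y ^ 2 / skellamProb l y
      ≤ fisherInfo (l / 2) ^ 2 := by
  have hl2 := half_pos hl
  set p := skellamProb (l / 2)
  have hne (z) : p z ≠ 0 := (skellamProb_pos hl2 z).ne'
  have hconv (y) : HasSum (fun z => p z * p (y - z)) (skellamProb l y) := by
    simpa only [add_halves] using hasSum_skellamProb_mul_skellamProb_sub hl2.le hl2.le y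
  refine sum_sq_div_le_of_hasSum s
    (k := fun y z => p z * p (y - z))
    (φ := fun y z => walkGenerator p z / p z * (walkGenerator p (y - z) / p (y - z)))
    (fun y z => mul_nonneg (skellamProb_nonneg hl2.le z) (skellamProb_nonneg hl2.le _))
    (skellamProb_pos hl) hconv (fun y => ?_) (fun z => ?_)
    (sq (fisherInfo (l / 2)) ▸ (hasSum_fisherInfo hl2).mul_right (fisherInfo (l / 2)))
  · convert! hasSum_walkGenerator_mul_walkGenerator_sub hconv y using 2 with z
    field_simp [hne]
  · calc ∑ y ∈ s, p z * p (y - z)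
          * (walkGenerator p z / p z * (walkGenerator p (y - z) / p (y - z))) ^ 2
        = walkGenerator p z ^ 2 / p z * ∑ y ∈ s, walkGenerator p (y - z) ^ 2 / p (y - z) := by
          rw [Finset.mul_sum]
          exact Finset.sum_congr rfl fun y _ => by field_simp [hne]
      _ ≤ walkGenerator p z ^ 2 / p z * fisherInfo (l / 2) :=
          mul_le_mul_of_nonneg_left
            (sum_le_hasSum s (fun y _ => sq_walkGenerator_skellamProb_div_nonneg hl2 (y - z))
              ((Equiv.subRight z).hasSum_iff.2 (hasSum_fisherInfo hl2)))
            (sq_walkGenerator_skellamProb_div_nonneg hl2 z)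

lemma hasSum_skellamProb_mul_sq_div_sub_one_sq (hl : 0 < l) :
    HasSum (fun y : ℤ => skellamProb l y * ((y : ℝ) ^ 2 / l - 1) ^ 2) (2 + 1 / l) := by
  have hfour := (hasSum_skellamProb_mul_pow_four hl.le).div_const (l ^ 2)
  have htwo := (hasSum_skellamProb_mul_sq hl.le).mul_right (2 / l)
  convert! (hfour.sub htwo).add (hasSum_skellamProb_one hl.le) using 1
  · ext y
    field_simp
    ring
  · field_simp
    ring

lemma sq_sub_le_add_mul_sq {ε : ℝ} (hε : 0 < ε) (a b : ℝ) :
    (a - b) ^ 2 ≤ (1 + ε) * a ^ 2 + (1 + 1 / ε) * b ^ 2 := by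
  have h : (1 + ε) * a ^ 2 + (1 + 1 / ε) * b ^ 2 - (a - b) ^ 2 = (ε * a + b) ^ 2 / ε := by
    field_simp
    ring
  linarith [div_nonneg (sq_nonneg (ε * a + b)) hε.le]

lemma sq_mul_fisherInfo_le (hl : 0 < l) {ε : ℝ} (hε : 0 < ε) :
    (2 * l + 1) ^ 2 * fisherInfo l
      ≤ (1 + ε) * (2 + 1 / l) + (1 + 1 / ε) * (l ^ 2 * fisherInfo (l / 2) ^ 2) := by
  rw [mul_comm, ← le_div_iff₀ (by positivity)]
  refine fisherInfo_le_of_sum_le hl fun s => ?_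
  rw [le_div_iff₀ (by positivity), Finset.sum_mul]
  set p := skellamProb l
  have hterm (y : ℤ) : walkGenerator p y ^ 2 / p y * (2 * l + 1) ^ 2
      ≤ (1 + ε) * (p y * ((y : ℝ) ^ 2 / l - 1) ^ 2)
        + (1 + 1 / ε) * (l ^ 2 * (walkGenerator (walkGenerator p) y ^ 2 / p y)) := by
    have hp : 0 < p y := skellamProb_pos hl y
    calc walkGenerator p y ^ 2 / p y * (2 * l + 1) ^ 2
        = (((y : ℝ) ^ 2 / l - 1) * p y - l * walkGenerator (walkGenerator p) y) ^ 2 / p y := by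
          rw [← walkGenerator_skellamProb_eq hl.ne']
          ring
      _ ≤ ((1 + ε) * (((y : ℝ) ^ 2 / l - 1) * p y) ^ 2
            + (1 + 1 / ε) * (l * walkGenerator (walkGenerator p) y) ^ 2) / p y := by
          gcongr
          exact sq_sub_le_add_mul_sq hε _ _
      _ = _ := by
          field_simp
  have hmoment := sum_le_hasSum s
    (fun y _ => mul_nonneg (skellamProb_nonneg hl.le y) (sq_nonneg _))
    (hasSum_skellamProb_mul_sq_div_sub_one_sq hl)
  have hsecond := sum_sq_walkGenerator_walkGenerator_skellamProb_div_le hl s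
  refine (Finset.sum_le_sum fun y _ => hterm y).trans ?_
  rw [Finset.sum_add_distrib, ← Finset.mul_sum, ← Finset.mul_sum, ← Finset.mul_sum]
  gcongr

lemma fisherInfo_le_four_div_sq (hl : 1 ≤ l) : fisherInfo l ≤ 4 / l ^ 2 := by
  have hl0 : 0 < l := zero_lt_one.trans_le hl
  have hhalf : l ^ 2 * fisherInfo (l / 2) ^ 2 ≤ 4 := by
    calc l ^ 2 * fisherInfo (l / 2) ^ 2 ≤ l ^ 2 * (1 / (l / 2)) ^ 2 := by
          have := fisherInfo_nonneg (half_pos hl0)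
          gcongr
          exact fisherInfo_le_inv (half_pos hl0)
      _ = 4 := by field_simp; norm_num
  have hinv : 1 / l ≤ 1 := (div_le_one hl0).2 hl
  have hrec := sq_mul_fisherInfo_le hl0 one_pos
  rw [le_div_iff₀ (by positivity)]
  nlinarith [mul_nonneg hl0.le (fisherInfo_nonneg hl0), fisherInfo_nonneg hl0]

lemma fisherInfo_le (hl : 2 ≤ l) : fisherInfo l ≤ (1 / 2 + 100 / l) / l ^ 2 := by
  have hl0 : 0 < l := zero_lt_two.trans_le hl
  have hhalf : l ^ 2 * fisherInfo (l / 2) ^ 2 ≤ 256 / l ^ 2 := by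
    calc l ^ 2 * fisherInfo (l / 2) ^ 2 ≤ l ^ 2 * (4 / (l / 2) ^ 2) ^ 2 := by
          have := fisherInfo_nonneg (half_pos hl0)
          gcongr
          exact fisherInfo_le_four_div_sq (by linarith)
      _ = 256 / l ^ 2 := by field_simp; norm_num
  have hrec := sq_mul_fisherInfo_le hl0 (one_div_pos.2 hl0)
  rw [one_div_one_div] at hrec
  have hrhs : (1 + 1 / l) * (2 + 1 / l) + (1 + l) * (256 / l ^ 2) ≤ 2 + 400 / l := by
    rw [← sub_nonneg]
    have : 2 + 400 / l - ((1 + 1 / l) * (2 + 1 / l) + (1 + l) * (256 / l ^ 2))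
      = (141 * l - 257) / l ^ 2 := by field_simp; ring
    rw [this]
    exact div_nonneg (by linarith) (sq_nonneg l)
  have hlhs : (2 * l) ^ 2 * fisherInfo l ≤ (2 * l + 1) ^ 2 * fisherInfo l := by
    have := fisherInfo_nonneg hl0
    gcongr
    linarith
  rw [le_div_iff₀ (by positivity)]
  have : (1 + l) * (l ^ 2 * fisherInfo (l / 2) ^ 2) ≤ (1 + l) * (256 / l ^ 2) := by gcongr
  linarith [show 400 / l = 4 * (100 / l) by ring]

lemma hasDerivAt_sqrt_skellamProb (hl : 0 < l) (y : ℤ) :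
    HasDerivAt (fun l => √(skellamProb l y))
      (walkGenerator (skellamProb l) y / (2 * √(skellamProb l y))) l :=
  (hasDerivAt_skellamProb l y).sqrt (skellamProb_pos hl y).ne'

lemma sum_sq_sqrt_skellamProb_sub_le {a b B : ℝ} (ha : 0 < a) (hb : 0 < b) (hB : 0 ≤ B)
    (hJ : ∀ l, min a b ≤ l → fisherInfo l ≤ B) (s : Finset ℤ) :
    ∑ y ∈ s, (√(skellamProb b y) - √(skellamProb a y)) ^ 2 ≤ B / 4 * (b - a) ^ 2 := by
  let root (l : ℝ) : EuclideanSpace ℝ s := WithLp.toLp 2 fun y => √(skellamProb l y)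
  let root' (l : ℝ) : EuclideanSpace ℝ s :=
    WithLp.toLp 2 fun y => walkGenerator (skellamProb l) y / (2 * √(skellamProb l y))
  have hpos {l} (hl : l ∈ Set.uIcc a b) : 0 < l := (lt_min ha hb).trans_le hl.1
  have hderiv (l) (hl : l ∈ Set.uIcc a b) : HasDerivWithinAt root (root' l) (Set.uIcc a b) l :=
    ((PiLp.hasFDerivAt_toLp 2 _).comp_hasDerivAt l (hasDerivAt_pi.2 fun y : s =>
      hasDerivAt_sqrt_skellamProb (hpos hl) y)).hasDerivWithinAt
  have hnorm (l) (hl : l ∈ Set.uIcc a b) : ‖root' l‖ ≤ √(B / 4) := by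
    rw [EuclideanSpace.norm_eq]
    refine Real.sqrt_le_sqrt ?_
    calc ∑ y : s, ‖root' l y‖ ^ 2
        = (∑ y ∈ s, walkGenerator (skellamProb l) y ^ 2 / skellamProb l y) / 4 := by
          rw [Finset.sum_div, ← Finset.sum_coe_sort s]
          refine Finset.sum_congr rfl fun y _ => ?_
          rw [Real.norm_eq_abs, sq_abs, div_pow, mul_pow,
            Real.sq_sqrt (skellamProb_nonneg (hpos hl).le _), div_div, mul_comm]
          norm_num
      _ ≤ B / 4 := by
          gcongr
          exact (sum_le_hasSum s (fun y _ => sq_walkGenerator_skellamProb_div_nonneg (hpos hl) y)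
            (hasSum_fisherInfo (hpos hl))).trans (hJ l hl.1)
  have hmvt := Convex.norm_image_sub_le_of_norm_hasDerivWithin_le hderiv hnorm
    (convex_uIcc a b) Set.left_mem_uIcc Set.right_mem_uIcc
  have hsq := pow_le_pow_left₀ (norm_nonneg _) hmvt 2
  rw [EuclideanSpace.norm_sq_eq, mul_pow, Real.sq_sqrt (by positivity), Real.norm_eq_abs,
    sq_abs] at hsq
  rw [← Finset.sum_coe_sort s]
  simpa [root] using hsq

end FisherInformation

section SkellamExperiment

variable {l m : ℝ≥0}

/-- The symmetric Skellam distribution `skellamProb l` as a measure. -/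
noncomputable def skellamMeasure (l : ℝ≥0) : Measure ℤ :=
  Measure.sum fun y => ENNReal.ofReal (skellamProb l y) • Measure.dirac y

lemma skellamMeasure_singleton (l : ℝ≥0) (y : ℤ) :
    skellamMeasure l {y} = ENNReal.ofReal (skellamProb l y) :=
  Measure.sum_smul_dirac_singleton

lemma integral_skellamMeasure (l : ℝ≥0) (g : ℤ → ℝ) :
    ∫ y, g y ∂skellamMeasure l = ∑' y, skellamProb l y * g y := by
  rw [skellamMeasure, integral_sum_dirac fun y => ENNReal.ofReal_ne_top]
  simp only [ENNReal.toReal_ofReal (skellamProb_nonneg l.coe_nonneg _), smul_eq_mul]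

lemma integrable_skellamMeasure_iff {g : ℤ → ℝ} :
    Integrable g (skellamMeasure l) ↔ Summable fun y => skellamProb l y * g y := by
  rw [skellamMeasure, integrable_sum_dirac_iff fun y => ENNReal.ofReal_ne_top,
    ← summable_abs_iff (f := fun y => skellamProb l y * g y)]
  simp only [ENNReal.toReal_ofReal (skellamProb_nonneg l.coe_nonneg _), abs_mul, Real.norm_eq_abs,
    abs_of_nonneg (skellamProb_nonneg l.coe_nonneg _)]

instance isProbabilityMeasure_skellamMeasure (l : ℝ≥0) :
    IsProbabilityMeasure (skellamMeasure l) := by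
  have hsum := hasSum_skellamProb_one l.coe_nonneg
  constructor
  rw [skellamMeasure, Measure.sum_apply _ MeasurableSet.univ]
  simp only [Measure.smul_apply, measure_univ, smul_eq_mul, mul_one]
  rw [← ENNReal.ofReal_tsum_of_nonneg (skellamProb_nonneg l.coe_nonneg) hsum.summable, hsum.tsum_eq,
    ENNReal.ofReal_one]

/-- The density of `skellamMeasure m` with respect to `skellamMeasure l`. -/
noncomputable def skellamRatio (l m : ℝ≥0) (y : ℤ) : ℝ := skellamProb m y / skellamProb l y

lemma skellamRatio_nonneg (l m : ℝ≥0) (y : ℤ) : 0 ≤ skellamRatio l m y :=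
  div_nonneg (skellamProb_nonneg m.coe_nonneg y) (skellamProb_nonneg l.coe_nonneg y)

lemma skellamRatio_pos (hl : 0 < l) (hm : 0 < m) (y : ℤ) : 0 < skellamRatio l m y :=
  div_pos (skellamProb_pos (NNReal.coe_pos.2 hm) y) (skellamProb_pos (NNReal.coe_pos.2 hl) y)

lemma skellamProb_mul_skellamRatio (hl : 0 < l) (m : ℝ≥0) (y : ℤ) :
    skellamProb l y * skellamRatio l m y = skellamProb m y :=
  mul_div_cancel₀ _ (skellamProb_pos (NNReal.coe_pos.2 hl) y).ne'

lemma integral_skellamRatio_mul (hl : 0 < l) (m : ℝ≥0) (g : ℤ → ℝ) :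
    ∫ y, skellamRatio l m y * g y ∂skellamMeasure l = ∫ y, g y ∂skellamMeasure m := by
  simp only [integral_skellamMeasure, ← mul_assoc, skellamProb_mul_skellamRatio hl]

lemma integrable_skellamRatio_mul_iff (hl : 0 < l) {g : ℤ → ℝ} :
    Integrable (fun y => skellamRatio l m y * g y) (skellamMeasure l)
      ↔ Integrable g (skellamMeasure m) := by
  simp only [integrable_skellamMeasure_iff, ← mul_assoc, skellamProb_mul_skellamRatio hl]

lemma integral_sqrt_skellamRatio_sub_one_sq_le (hl : 0 < l) (hm : 0 < m) {B : ℝ} (hB : 0 ≤ B)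
    (hJ : ∀ x, min (l : ℝ) m ≤ x → fisherInfo x ≤ B) :
    ∫ y, (√(skellamRatio l m y) - 1) ^ 2 ∂skellamMeasure l ≤ B / 4 * ((m : ℝ) - l) ^ 2 := by
  have hroot (y : ℤ) : skellamProb l y * (√(skellamRatio l m y) - 1) ^ 2
      = (√(skellamProb m y) - √(skellamProb l y)) ^ 2 := by
    have hp := skellamProb_pos (NNReal.coe_pos.2 hl) y
    nth_rewrite 1 [← Real.sq_sqrt hp.le]
    rw [skellamRatio, Real.sqrt_div (skellamProb_nonneg m.coe_nonneg y), ← mul_pow, mul_sub,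
      mul_one, mul_div_cancel₀ _ (Real.sqrt_pos.2 hp).ne']
  rw [integral_skellamMeasure]
  simp only [hroot]
  exact Real.tsum_le_of_sum_le (fun y => sq_nonneg _)
    (sum_sq_sqrt_skellamProb_sub_le (NNReal.coe_pos.2 hl) (NNReal.coe_pos.2 hm) hB hJ)

/-- The standardised squared increment. For large `l` it is asymptotically the standardised score
of the family `skellamProb` at `l`. -/
noncomputable def squareScore (l : ℝ) (y : ℤ) : ℝ := ((y : ℝ) ^ 2 / l - 1) / √2

lemma integral_squareScore (l m : ℝ≥0) :
    ∫ y, squareScore l y ∂skellamMeasure m = ((m : ℝ) / l - 1) / √2 := by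
  rw [integral_skellamMeasure]
  refine HasSum.tsum_eq ?_
  convert! (((hasSum_skellamProb_mul_sq m.coe_nonneg).div_const (l : ℝ)).sub
    (hasSum_skellamProb_one m.coe_nonneg)).div_const √2 using 2 with y
  rw [squareScore]
  ring

lemma integral_squareScore_sq (hl : 0 < l) :
    ∫ y, squareScore l y ^ 2 ∂skellamMeasure l = (2 + 1 / (l : ℝ)) / 2 := by
  rw [integral_skellamMeasure]
  refine HasSum.tsum_eq ?_
  convert! (hasSum_skellamProb_mul_sq_div_sub_one_sq (NNReal.coe_pos.2 hl)).div_const 2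
    using 2 with y
  rw [squareScore, div_pow, Real.sq_sqrt zero_le_two, mul_div_assoc]

lemma pow_eight_le_mul_cosh (u : ℝ) : u ^ 8 ≤ 80640 * Real.cosh u := by
  have hexp := Real.pow_div_factorial_le_exp |u| (abs_nonneg u) 8
  rw [Even.pow_abs (by decide), div_le_iff₀ (by positivity)] at hexp
  have hcosh : Real.exp |u| ≤ 2 * Real.cosh u := by
    rw [← Real.cosh_abs, Real.cosh_eq]
    linarith [Real.exp_pos (-|u|)]
  norm_num [Nat.factorial] at hexp
  linarith

/-- The constant is `(8 * (2 * 8!) + 8) / 4`, from `(u² - 1)⁴ ≤ 8 (u⁸ + 1)` and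
`u⁸ ≤ 2 * 8! * cosh u`. -/
lemma squareScore_pow_four_le {l : ℝ} (hl : 0 ≤ l) (y : ℤ) :
    squareScore l y ^ 4 ≤ 161282 * Real.cosh (1 / √l * y) := by
  set u := 1 / √l * y
  have hu : (y : ℝ) ^ 2 / l = u ^ 2 := by
    rw [mul_pow, div_pow, one_pow, Real.sq_sqrt hl, one_div_mul_eq_div]
  have hsqrt : √2 ^ 4 = (4 : ℝ) := by
    rw [show √2 ^ 4 = (√2 ^ 2) ^ 2 by ring, Real.sq_sqrt zero_le_two]
    norm_num
  have hpow : (u ^ 2 - 1) ^ 4 ≤ 8 * (u ^ 8 + 1) := by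
    nlinarith [sq_nonneg (u ^ 4 - 1), sq_nonneg (u ^ 2 + 1), sq_nonneg (u ^ 4 + 2 * u ^ 2 + 1),
      sq_nonneg (u ^ 2 * (u ^ 2 + 1)), sq_nonneg (u ^ 4 + u ^ 2), sq_nonneg (u ^ 3 + u)]
  rw [squareScore, hu, div_pow, hsqrt]
  linarith [pow_eight_le_mul_cosh u, Real.one_le_cosh u]

lemma summable_skellamProb_mul_squareScore_pow_four (l m : ℝ≥0) :
    Summable fun y => skellamProb m y * squareScore l y ^ 4 := by
  refine .of_nonneg_of_le (fun y => mul_nonneg (skellamProb_nonneg m.coe_nonneg y) (by positivity))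
    (fun y => mul_le_mul_of_nonneg_left (squareScore_pow_four_le l.coe_nonneg y)
      (skellamProb_nonneg m.coe_nonneg y))
    ?_
  exact ((hasSum_skellamProb_mul_cosh m.coe_nonneg (1 / √(l : ℝ))).summable.mul_left 161282).congr
    fun y => mul_left_comm _ _ _

lemma integrable_squareScore_pow_four (l m : ℝ≥0) :
    Integrable (fun y => squareScore l y ^ 4) (skellamMeasure m) :=
  integrable_skellamMeasure_iff.2 (summable_skellamProb_mul_squareScore_pow_four l m)

lemma integral_squareScore_pow_four_le (hl : 1 ≤ l) (hm : m ≤ 2 * l) :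
    ∫ y, squareScore l y ^ 4 ∂skellamMeasure m ≤ 161282 * Real.exp 2 := by
  have : (1 : ℝ) ≤ l := mod_cast hl
  have hcosh : Real.cosh (1 / √(l : ℝ)) - 1 ≤ 1 / l := by
    have hsq : (1 / √(l : ℝ)) ^ 2 / 2 = 1 / (2 * l) := by
      rw [div_pow, Real.sq_sqrt l.coe_nonneg, one_pow, div_div, mul_comm]
    have habs : |1 / (2 * (l : ℝ))| = 1 / (2 * l) := abs_of_nonneg (by positivity)
    have hsmall : 1 / (2 * (l : ℝ)) ≤ 1 := (div_le_one (by positivity)).2 (by linarith)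
    calc Real.cosh (1 / √(l : ℝ)) - 1 ≤ Real.exp (1 / (2 * l)) - 1 :=
          sub_le_sub_right (hsq ▸ Real.cosh_le_exp_half_sq _) 1
      _ ≤ 2 * (1 / (2 * l)) :=
          (le_abs_self _).trans ((Real.abs_exp_sub_one_le (habs.trans_le hsmall)).trans_eq
            (by rw [habs]))
      _ = 1 / l := by field_simp
  have hexponent : (m : ℝ) * (Real.cosh (1 / √(l : ℝ)) - 1) ≤ 2 := by
    calc (m : ℝ) * (Real.cosh (1 / √(l : ℝ)) - 1) ≤ (2 * l : ℝ) * (1 / l) := by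
          gcongr
          · linarith [Real.one_le_cosh (1 / √(l : ℝ))]
          · exact mod_cast hm
      _ = 2 := by field_simp
  rw [integral_skellamMeasure]
  refine (hasSum_le (fun y => ?_) (summable_skellamProb_mul_squareScore_pow_four l m).hasSum
    ((hasSum_skellamProb_mul_cosh m.coe_nonneg (1 / √(l : ℝ))).mul_left 161282)).trans
    (by gcongr)
  rw [mul_left_comm]
  exact mul_le_mul_of_nonneg_left (squareScore_pow_four_le l.coe_nonneg y)
    (skellamProb_nonneg m.coe_nonneg y)

end SkellamExperiment

section SkellamAsymptotics

variable {ι : Type*} {F : Filter ι} {n : ι → ℕ} {l m : ι → ℝ≥0} {v : ℝ}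

lemma isAsymptoticallyStandard_squareScore (hl : Tendsto l F atTop) :
    IsAsymptoticallyStandard F (fun i => skellamMeasure (l i)) fun i => squareScore (l i) where
  measurable i := .of_discrete
  memLp_four i := by
    rw [← integrable_norm_rpow_iff Measurable.of_discrete.aestronglyMeasurable (by norm_num)
      (by norm_num)]
    convert! integrable_squareScore_pow_four (l i) (l i) using 2 with y
    norm_num
    exact Even.pow_abs (by decide) _
  integral_eq_zero := by
    filter_upwards [hl.eventually_gt_atTop 0] with i hi
    rw [integral_squareScore, div_self (mod_cast hi.ne'), sub_self, zero_div]
  tendsto_integral_sq := by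
    have hinv : Tendsto (fun i => 1 / (l i : ℝ)) F (𝓝 0) :=
      (NNReal.tendsto_coe_atTop.2 hl).const_div_atTop 1
    have hlim : Tendsto (fun i => (2 + 1 / (l i : ℝ)) / 2) F (𝓝 1) := by
      simpa using (hinv.const_add 2).div_const 2
    refine hlim.congr' ?_
    filter_upwards [hl.eventually_gt_atTop 0] with i hi
    rw [integral_squareScore_sq hi]
  exists_integral_pow_four_le := by
    refine ⟨161282 * Real.exp 2, ?_⟩
    filter_upwards [hl.eventually_ge_atTop 1] with i hi
    exact integral_squareScore_pow_four_le hi (le_mul_of_one_le_left' one_le_two)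

lemma tendsto_one_of_tendsto_sqrt_mul_sub_one (hn : Tendsto n F atTop) {x : ι → ℝ} {c : ℝ}
    (hx : Tendsto (fun i => √(n i) * (x i - 1)) F (𝓝 c)) : Tendsto x F (𝓝 1) := by
  have hsqrt : Tendsto (fun i => √(n i : ℝ)) F atTop :=
    Real.tendsto_sqrt_atTop.comp (tendsto_natCast_atTop_atTop.comp hn)
  have hsub : Tendsto (fun i => x i - 1) F (𝓝 0) := by
    refine (hx.div_atTop hsqrt).congr' ?_
    filter_upwards [hsqrt.eventually_gt_atTop 0] with i hi
    exact mul_div_cancel_left₀ _ hi.ne'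
  simpa using hsub.add_const 1

lemma exists_hellinger_skellamRatio_le (hn : Tendsto n F atTop) (hl : Tendsto l F atTop)
    (hm : Tendsto (fun i => √(n i) * ((m i : ℝ) / l i - 1)) F (𝓝 (v * √2))) :
    ∃ b : ι → ℝ, Tendsto b F (𝓝 (v ^ 2 / 4)) ∧ ∀ᶠ i in F,
      n i * ∫ y, (√(skellamRatio (l i) (m i) y) - 1) ^ 2 ∂skellamMeasure (l i) ≤ b i := by
  have hratio : Tendsto (fun i => min (1 : ℝ) (m i / l i)) F (𝓝 1) := by
    simpa using (tendsto_const_nhds (x := (1 : ℝ))).min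
      (tendsto_one_of_tendsto_sqrt_mul_sub_one hn hm)
  have hl' : Tendsto (fun i => (l i : ℝ)) F atTop := NNReal.tendsto_coe_atTop.2 hl
  have hmin : Tendsto (fun i => l i * min (1 : ℝ) (m i / l i)) F atTop :=
    hl'.atTop_mul_pos one_pos hratio
  refine ⟨fun i => (√(n i) * ((m i : ℝ) / l i - 1)) ^ 2 / 4
    * ((1 / 2 + 100 / (l i * min (1 : ℝ) (m i / l i))) / min (1 : ℝ) (m i / l i) ^ 2), ?_, ?_⟩
  · convert! ((hm.pow 2).div_const 4).mul
      (((hmin.const_div_atTop 100).const_add (1 / 2)).div (hratio.pow 2) (by norm_num)) using 2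
    rw [mul_pow, Real.sq_sqrt zero_le_two]
    ring
  · filter_upwards [hmin.eventually_ge_atTop 2, hl'.eventually_gt_atTop 0] with i hi hli
    have hmineq : l i * min (1 : ℝ) (m i / l i) = min (l i : ℝ) (m i) := by
      rw [mul_min_of_nonneg _ _ hli.le, mul_one, mul_div_cancel₀ _ hli.ne']
    rw [hmineq] at hi
    set k := min (l i : ℝ) (m i)
    have hk0 : 0 < k := zero_lt_two.trans_le hi
    have hmi : (0 : ℝ) < m i := hk0.trans_le (min_le_right _ _)
    have hJ (x : ℝ) (hx : k ≤ x) : fisherInfo x ≤ (1 / 2 + 100 / k) / k ^ 2 :=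
      (fisherInfo_le (hi.trans hx)).trans (by gcongr)
    have hellinger := integral_sqrt_skellamRatio_sub_one_sq_le hli hmi (by positivity) hJ
    refine (mul_le_mul_of_nonneg_left hellinger (n i).cast_nonneg).trans_eq ?_
    rw [hmineq, eq_div_of_mul_eq hli.ne' ((mul_comm _ _).trans hmineq), mul_pow,
      Real.sq_sqrt (n i).cast_nonneg]
    field_simp

lemma isLocalAlternative_skellamRatio (hn : Tendsto n F atTop) (hl : Tendsto l F atTop)
    (hm : Tendsto (fun i => √(n i) * ((m i : ℝ) / l i - 1)) F (𝓝 (v * √2))) :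
    IsLocalAlternative F n (fun i => skellamMeasure (l i)) (fun i => squareScore (l i)) v
      fun i => skellamRatio (l i) (m i) where
  measurable i := .of_discrete
  nonneg i := skellamRatio_nonneg (l i) (m i)
  integral_eq_one := by
    filter_upwards [hl.eventually_gt_atTop 0] with i hi
    simpa using integral_skellamRatio_mul hi (m i) fun _ => 1
  integrable_mul_pow_four := by
    filter_upwards [hl.eventually_gt_atTop 0] with i hi
    exact (integrable_skellamRatio_mul_iff hi).2 (integrable_squareScore_pow_four (l i) (m i))
  exists_integral_mul_pow_four_le := by
    refine ⟨161282 * Real.exp 2, ?_⟩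
    have hratio := (tendsto_one_of_tendsto_sqrt_mul_sub_one hn hm).eventually_le_const one_lt_two
    filter_upwards [hl.eventually_ge_atTop 1, hratio] with i hi hmi
    have hli : 0 < l i := one_pos.trans_le hi
    rw [integral_skellamRatio_mul hli]
    rw [div_le_iff₀ (mod_cast hli)] at hmi
    exact integral_squareScore_pow_four_le hi (mod_cast hmi)
  tendsto_sqrt_mul_integral := by
    have hlim := hm.div_const √2
    rw [mul_div_cancel_right₀ _ (Real.sqrt_pos.2 zero_lt_two).ne'] at hlim
    refine hlim.congr' ?_
    filter_upwards [hl.eventually_gt_atTop 0] with i hi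
    rw [integral_skellamRatio_mul hi, integral_squareScore, mul_div_assoc]
  exists_hellinger_le := exists_hellinger_skellamRatio_le hn hl hm

end SkellamAsymptotics

section Increments

variable {Ω : Type*} [MeasurableSpace Ω] {P : Measure Ω}

lemma measure_prodMk_mem_eq_lintegral {α β : Type*} [MeasurableSpace α] [MeasurableSpace β]
    [IsFiniteMeasure P] {f : Ω → α} {g : Ω → β} (h : IndepFun f g P) (hf : Measurable f)
    (hg : Measurable g) {S : Set (α × β)} (hS : MeasurableSet S) :
    P {ω | (f ω, g ω) ∈ S} = ∫⁻ ω, P {ω' | (f ω, g ω') ∈ S} ∂P := by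
  change P ((fun ω => (f ω, g ω)) ⁻¹' S) = _
  rw [← Measure.map_apply (hf.prodMk hg) hS,
    (indepFun_iff_map_prod_eq_prod_map_map hf.aemeasurable hg.aemeasurable).1 h,
    Measure.prod_apply hS, lintegral_map (measurable_measure_prodMk_left hS) hf]
  exact lintegral_congr fun ω => Measure.map_apply hg (measurable_prodMk_left hS)

/-- The sum of `e` over the `i`-th of the successive blocks of indices of lengths
`m 0, m 1, …`. -/
def blockSum (m : ℕ → ℕ) (e : ℕ → ℤ) (i : ℕ) : ℤ :=
  ∑ j ∈ Finset.Ico (∑ k ∈ Finset.range i, m k) (∑ k ∈ Finset.range (i + 1), m k), e j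

lemma measurable_blockSum (i : ℕ) :
    Measurable fun q : (ℕ → ℕ) × (ℕ → ℤ) => blockSum q.1 q.2 i := by
  have hsum : Measurable fun q : (ℕ × ℕ) × (ℕ → ℤ) => ∑ j ∈ Finset.Ico q.1.1 q.1.2, q.2 j :=
    measurable_from_prod_countable_right fun p => by dsimp only; fun_prop
  have hends : Measurable fun q : (ℕ → ℕ) × (ℕ → ℤ) =>
      (((∑ k ∈ Finset.range i, q.1 k, ∑ k ∈ Finset.range (i + 1), q.1 k), q.2) :
        (ℕ × ℕ) × (ℕ → ℤ)) := by
    fun_prop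
  exact hsum.comp hends

namespace IsSymmetricBernoulliSequence

variable {ε : ℕ → Ω → ℤ}

lemma measure_inter_eq_mul (hε : IsSymmetricBernoulliSequence ε P) (c : ℕ) {A B : Set Ω}
    (hA : MeasurableSet[⨆ j ∈ Set.Iio c, MeasurableSpace.comap (ε j) inferInstance] A)
    (hB : MeasurableSet[⨆ j ∈ Set.Ici c, MeasurableSpace.comap (ε j) inferInstance] B) :
    P (A ∩ B) = P A * P B :=
  (Indep_iff _ _ P).1 (indep_iSup_of_disjoint (fun j => (hε.measurable j).comap_le) hε.indep
    (Set.Iio_disjoint_Ici le_rfl)) A B hA hB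

variable [IsProbabilityMeasure P]

lemma ae_eq_one_or_neg_one (hε : IsSymmetricBernoulliSequence ε P) (i : ℕ) :
    ∀ᵐ ω ∂P, ε i ω = 1 ∨ ε i ω = -1 := by
  have hmeas (e : ℤ) : MeasurableSet {ω | ε i ω = e} :=
    hε.measurable i (measurableSet_singleton e)
  have hdisj : Disjoint {ω | ε i ω = 1} {ω | ε i ω = -1} :=
    Set.disjoint_left.2 fun ω h1 h2 => absurd (h1.symm.trans h2) (by decide)
  have hunion : P ({ω | ε i ω = 1} ∪ {ω | ε i ω = -1}) = 1 := by
    rw [measure_union hdisj (hmeas _), hε.prob_one, hε.prob_neg_one, ENNReal.add_halves]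
  exact (prob_compl_eq_zero_iff ((hmeas 1).union (hmeas (-1)))).2 hunion

lemma measure_add_eq (hε : IsSymmetricBernoulliSequence ε P) {i : ℕ} {Z : Ω → ℤ}
    (hZ : Measurable Z) (hind : IndepFun (ε i) Z P) (y : ℤ) :
    P {ω | ε i ω + Z ω = y} = (P {ω | Z ω = y - 1} + P {ω | Z ω = y + 1}) / 2 := by
  have hprod (e z : ℤ) : P ({ω | ε i ω = e} ∩ {ω | Z ω = z})
      = P {ω | ε i ω = e} * P {ω | Z ω = z} :=
    hind.measure_inter_preimage_eq_mul {e} {z} (measurableSet_singleton e)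
      (measurableSet_singleton z)
  have hdisj : Disjoint ({ω | ε i ω = 1} ∩ {ω | Z ω = y - 1})
      ({ω | ε i ω = -1} ∩ {ω | Z ω = y + 1}) :=
    Set.disjoint_left.2 fun ω h1 h2 => absurd (h1.1.symm.trans h2.1) (by decide)
  have hsplit : P {ω | ε i ω + Z ω = y}
      = P ({ω | ε i ω = 1} ∩ {ω | Z ω = y - 1} ∪ {ω | ε i ω = -1} ∩ {ω | Z ω = y + 1}) := by
    refine measure_congr ?_
    filter_upwards [hε.ae_eq_one_or_neg_one i] with ω hω
    refine propext (?_ : ε i ω + Z ω = y ↔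
      (ε i ω = 1 ∧ Z ω = y - 1) ∨ (ε i ω = -1 ∧ Z ω = y + 1))
    omega
  rw [hsplit, measure_union hdisj ((hε.measurable i (measurableSet_singleton _)).inter
    (hZ (measurableSet_singleton _))), hprod, hprod, hε.prob_one, hε.prob_neg_one, ← mul_add,
    one_div, ← ENNReal.div_eq_inv_mul]

lemma measure_sum_eq (hε : IsSymmetricBernoulliSequence ε P) (S : Finset ℕ) (y : ℤ) :
    P {ω | ∑ j ∈ S, ε j ω = y} = ENNReal.ofReal (walkProb S.card y) := by
  induction S using Finset.induction_on generalizing y with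
  | empty =>
    rw [Finset.card_empty, walkProb_zero]
    rcases eq_or_ne y 0 with rfl | hy
    · simp
    · simp [hy, hy.symm]
  | insert i S hi ih =>
    have hind : IndepFun (ε i) (∑ j ∈ S, ε j) P :=
      (hε.indep.indepFun_finsetSum_of_notMem hε.measurable hi).symm
    have hadd := hε.measure_add_eq (Finset.measurable_sum S fun j _ => hε.measurable j)
      (by simpa only [← Finset.sum_apply] using hind) y
    simp only [Finset.sum_insert hi, Finset.card_insert_of_notMem hi]
    rw [hadd, ih, ih, walkProb_succ, walkStep, ← ENNReal.ofReal_add (walkProb_nonneg _ _)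
      (walkProb_nonneg _ _), ENNReal.ofReal_div_of_pos zero_lt_two, ENNReal.ofReal_ofNat]

lemma measure_blockSum_eq (hε : IsSymmetricBernoulliSequence ε P) (m : ℕ → ℕ) (y : ℕ → ℤ)
    (n : ℕ) :
    P {ω | ∀ i < n, blockSum m (fun j => ε j ω) i = y i}
      = ∏ i ∈ Finset.range n, ENNReal.ofReal (walkProb (m i) (y i)) := by
  have hmeas {J : Set ℕ} {S : Finset ℕ} (hS : ↑S ⊆ J) (z : ℤ) :
      MeasurableSet[⨆ j ∈ J, MeasurableSpace.comap (ε j) inferInstance]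
        {ω | ∑ j ∈ S, ε j ω = z} := by
    refine Finset.measurable_sum S (fun j hj => ?_) (measurableSet_singleton z)
    exact (comap_measurable (ε j)).mono
      (le_iSup₂_of_le (f := fun j (_ : j ∈ J) => MeasurableSpace.comap (ε j) inferInstance)
        j (hS hj) le_rfl) le_rfl
  induction n with
  | zero => simp
  | succ n ih =>
    set c : ℕ → ℕ := fun i => ∑ k ∈ Finset.range i, m k
    have hc : Monotone c := fun i j hij =>
      Finset.sum_le_sum_of_subset (Finset.range_subset_range.2 hij)
    have hpast : MeasurableSet[⨆ j ∈ Set.Iio (c n), MeasurableSpace.comap (ε j) inferInstance]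
        {ω | ∀ i < n, blockSum m (fun j => ε j ω) i = y i} := by
      simp only [Set.ofPred_forall]
      refine .iInter fun i => .iInter fun hi => hmeas (fun j hj => ?_) _
      exact (Finset.mem_Ico.1 hj).2.trans_le (hc hi)
    have hnext : MeasurableSet[⨆ j ∈ Set.Ici (c n), MeasurableSpace.comap (ε j) inferInstance]
        {ω | blockSum m (fun j => ε j ω) n = y n} :=
      hmeas (fun j hj => (Finset.mem_Ico.1 hj).1) _
    have hlast : P {ω | blockSum m (fun j => ε j ω) n = y n}
        = ENNReal.ofReal (walkProb (m n) (y n)) := by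
      simp only [blockSum, hε.measure_sum_eq, Nat.card_Ico, Finset.sum_range_succ,
        add_tsub_cancel_left]
    rw [Finset.prod_range_succ, ← ih, ← hlast, ← hε.measure_inter_eq_mul (c n) hpast hnext]
    simp only [Nat.forall_lt_succ_right, Set.ofPred_and]

lemma measure_blockSum_random_eq (hε : IsSymmetricBernoulliSequence ε P) {A : Ω → ℕ → ℕ}
    (hA : Measurable A) (hAε : IndepFun A (fun ω i => ε i ω) P)
    (hAind : iIndepFun (fun i ω => A ω i) P) (y : ℕ → ℤ) (n : ℕ) :
    P {ω | ∀ i < n, blockSum (A ω) (fun j => ε j ω) i = y i}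
      = ∏ i ∈ Finset.range n, ∫⁻ ω, ENNReal.ofReal (walkProb (A ω i) (y i)) ∂P := by
  have hS : MeasurableSet {q : (ℕ → ℕ) × (ℕ → ℤ) | ∀ i < n, blockSum q.1 q.2 i = y i} := by
    simp only [Set.ofPred_forall]
    exact .iInter fun i => .iInter fun _ => measurable_blockSum i (measurableSet_singleton _)
  have hwalk (i : ℕ) : Measurable fun a : ℕ => ENNReal.ofReal (walkProb a (y i)) := .of_discrete
  calc P {ω | ∀ i < n, blockSum (A ω) (fun j => ε j ω) i = y i}
      = ∫⁻ ω, P {ω' | ∀ i < n, blockSum (A ω) (fun j => ε j ω') i = y i} ∂P :=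
        measure_prodMk_mem_eq_lintegral hAε hA (measurable_pi_lambda _ hε.measurable) hS
    _ = ∫⁻ ω, ∏ i ∈ Finset.range n, ENNReal.ofReal (walkProb (A ω i) (y i)) ∂P := by
        simp only [hε.measure_blockSum_eq]
    _ = ∏ i ∈ Finset.range n, ∫⁻ ω, ENNReal.ofReal (walkProb (A ω i) (y i)) ∂P :=
        lintegral_prod_eq_prod_lintegral_of_indepFun (Finset.range n)
          (fun i ω => ENNReal.ofReal (walkProb (A ω i) (y i)))
          (hAind.comp (fun i a => ENNReal.ofReal (walkProb a (y i))) hwalk)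
          fun i => (hwalk i).comp ((measurable_pi_apply i).comp hA)

end IsSymmetricBernoulliSequence

lemma lintegral_walkProb_poissonMeasure (l : ℝ≥0) (y : ℤ) :
    ∫⁻ a, ENNReal.ofReal (walkProb a y) ∂poissonMeasure l = skellamMeasure l {y} := by
  rw [lintegral_countable', skellamMeasure_singleton, skellamProb,
    ENNReal.ofReal_tsum_of_nonneg
      (fun a => mul_nonneg (poissonWeight_nonneg l.coe_nonneg a) (walkProb_nonneg a y))
      (hasSum_skellamProb l y).summable]
  refine tsum_congr fun a => ?_
  rw [poissonMeasure_singleton, ENNReal.ofReal_mul (poissonWeight_nonneg l.coe_nonneg a), mul_comm]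
  rfl

lemma IsPoissonProcess.ae_eq_sum_increments {ϑ : ℝ} {N : ℝ≥0 → Ω → ℕ}
    (hN : IsPoissonProcess ϑ N P) {t : ℕ → ℝ≥0} (ht : Monotone t) (ht0 : t 0 = 0) :
    ∀ᵐ ω ∂P, ∀ i, N (t i) ω = ∑ k ∈ Finset.range i, (N (t (k + 1)) ω - N (t k) ω) := by
  filter_upwards [hN.start_zero, hN.monotone_path] with ω h0 hmono i
  simpa only [Function.comp_apply, ht0, h0, tsub_zero] using
    (Finset.sum_range_tsub (hmono.comp ht) i).symm

namespace IsBernoulliCompoundPoisson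

variable {ϑ : ℝ} {X : ℝ≥0 → Ω → ℤ}

lemma measurable (hX : IsBernoulliCompoundPoisson ϑ X P) (t : ℝ≥0) : Measurable (X t) := by
  obtain ⟨N, ε, hN, hε, -, hXeq⟩ := hX
  have hsum : Measurable fun q : ℕ × Ω => ∑ j ∈ Finset.range q.1, ε j q.2 :=
    measurable_from_prod_countable_right fun k =>
      Finset.measurable_sum (Finset.range k) fun j _ => hε.measurable j
  rw [funext (hXeq t)]
  exact hsum.comp ((hN.measurable t).prodMk measurable_id)

lemma ae_zero (hX : IsBernoulliCompoundPoisson ϑ X P) : ∀ᵐ ω ∂P, X 0 ω = 0 := by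
  obtain ⟨N, ε, hN, -, -, hXeq⟩ := hX
  filter_upwards [hN.start_zero] with ω h0
  rw [hXeq, h0, Finset.sum_range_zero]

lemma measure_increments_eq [IsProbabilityMeasure P] (hX : IsBernoulliCompoundPoisson ϑ X P)
    {t : ℕ → ℝ≥0} (ht : Monotone t) (ht0 : t 0 = 0) (y : ℕ → ℤ) (n : ℕ) :
    P {ω | ∀ i < n, X (t (i + 1)) ω - X (t i) ω = y i}
      = ∏ i ∈ Finset.range n, skellamMeasure (ϑ.toNNReal * (t (i + 1) - t i)) {y i} := by
  obtain ⟨N, ε, hN, hε, hNε, hXeq⟩ := hX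
  set A : Ω → ℕ → ℕ := fun ω i => N (t (i + 1)) ω - N (t i) ω
  have hA : Measurable A :=
    measurable_pi_lambda _ fun i => (hN.measurable _).sub (hN.measurable _)
  have hAε : IndepFun A (fun ω i => ε i ω) P :=
    hNε.comp (φ := fun (f : ℝ≥0 → ℕ) i => f (t (i + 1)) - f (t i)) (ψ := id) (by fun_prop)
      measurable_id
  have hblock : P {ω | ∀ i < n, X (t (i + 1)) ω - X (t i) ω = y i}
      = P {ω | ∀ i < n, blockSum (A ω) (fun j => ε j ω) i = y i} := by
    refine measure_congr ?_
    filter_upwards [hN.ae_eq_sum_increments ht ht0, hN.monotone_path] with ω hsum hmono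
    have hle (i : ℕ) : N (t i) ω ≤ N (t (i + 1)) ω := hmono (ht i.le_succ)
    refine propext (forall₂_congr fun i _ => ?_)
    rw [hXeq, hXeq, ← Finset.sum_Ico_eq_sub _ (hle i), hsum i, hsum (i + 1)]
    rfl
  rw [hblock, hε.measure_blockSum_random_eq hA hAε (hN.indep_increments.nat ht)]
  refine Finset.prod_congr rfl fun i _ => ?_
  rw [← lintegral_walkProb_poissonMeasure, ← hN.increment_law _ _ (ht i.le_succ)]
  exact (lintegral_map (f := fun a : ℕ => ENNReal.ofReal (walkProb a (y i))) .of_discrete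
    ((hN.measurable _).sub (hN.measurable _))).symm

end IsBernoulliCompoundPoisson

/-- The increments of a path observed at successive times, when the path starts at `0`. -/
def increments {n : ℕ} (x : Fin n → ℤ) (i : Fin n) : ℤ :=
  x i - (Fin.cons 0 x : Fin (n + 1) → ℤ) i.castSucc

lemma increments_injective {n : ℕ} : Function.Injective (increments (n := n)) := by
  intro x x' h
  have hcons (i : Fin (n + 1)) :
      (Fin.cons 0 x : Fin (n + 1) → ℤ) i = (Fin.cons 0 x' : Fin (n + 1) → ℤ) i := by
    induction i using Fin.induction with
    | zero => rfl
    | succ i ih =>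
      have hi := congrFun h i
      rw [increments, increments, ih] at hi
      simpa only [Fin.cons_succ] using sub_left_injective hi
  exact funext fun i => by simpa only [Fin.cons_succ] using hcons i.succ

lemma increments_eval_grid (f : ℝ≥0 → ℤ) (h0 : f 0 = 0) (Δ : ℝ) {n : ℕ} (i : Fin n) :
    increments (fun j : Fin n => f (((j : ℝ) + 1) * Δ).toNNReal) i
      = f ((i + 1 : ℕ) * Δ.toNNReal) - f ((i : ℕ) * Δ.toNNReal) := by
  have htime (k : ℕ) : (((k : ℝ) + 1) * Δ).toNNReal = (k + 1 : ℕ) * Δ.toNNReal := by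
    rw [← Nat.cast_add_one, Real.toNNReal_mul (Nat.cast_nonneg _), Real.toNNReal_natCast]
  have hcons (j : Fin (n + 1)) :
      (Fin.cons 0 (fun j : Fin n => f (((j : ℝ) + 1) * Δ).toNNReal) : Fin (n + 1) → ℤ) j
        = f ((j : ℕ) * Δ.toNNReal) := by
    refine Fin.cases ?_ (fun j => ?_) j
    · simp [h0]
    · rw [Fin.cons_succ, htime, Fin.val_succ]
  rw [increments, hcons, htime, Fin.val_castSucc]

lemma observationLaw_map_increments [IsProbabilityMeasure P] {ϑ : ℝ} {X : ℝ≥0 → Ω → ℤ}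
    (hX : IsBernoulliCompoundPoisson ϑ X P) (T Δ : ℝ) :
    (observationLaw P X T Δ).map increments
      = Measure.pi fun _ => skellamMeasure (ϑ.toNNReal * Δ.toNNReal) := by
  set n := ⌊T / Δ⌋₊
  set t : ℕ → ℝ≥0 := fun i => i * Δ.toNNReal
  have ht : Monotone t := fun i j hij => mul_le_mul_left (Nat.cast_le.2 hij) _
  have hstep (i : ℕ) : t (i + 1) - t i = Δ.toNNReal := by
    simp only [t, Nat.cast_add_one, add_mul, one_mul, add_tsub_cancel_left]
  have hobs : Measurable fun ω (i : Fin n) => X (((i : ℝ) + 1) * Δ).toNNReal ω :=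
    measurable_pi_lambda _ fun i => hX.measurable _
  refine Measure.ext_of_singleton fun y => ?_
  have hy := hX.measure_increments_eq ht (by simp [t])
    (fun i => if hi : i < n then y ⟨i, hi⟩ else 0) n
  simp only [Finset.prod_range, hstep, Fin.is_lt, dite_true, Fin.eta] at hy
  rw [Measure.pi_singleton, ← hy, observationLaw, Measure.map_map .of_discrete hobs,
    Measure.map_apply (Measurable.of_discrete.comp hobs) (measurableSet_singleton y)]
  refine measure_congr ?_
  filter_upwards [hX.ae_zero] with ω h0
  refine propext (?_ : increments (fun i : Fin n => X (((i : ℝ) + 1) * Δ).toNNReal ω) = y ↔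
    ∀ i < n, X (t (i + 1)) ω - X (t i) ω = if hi : i < n then y ⟨i, hi⟩ else 0)
  simp only [funext_iff, increments_eval_grid (fun s => X s ω) h0, Fin.forall_iff]
  exact forall₂_congr fun i hi => by rw [dif_pos hi]

lemma observationLaw_singleton [IsProbabilityMeasure P] {ϑ : ℝ} {X : ℝ≥0 → Ω → ℤ}
    (hX : IsBernoulliCompoundPoisson ϑ X P) (T Δ : ℝ) (x : Fin ⌊T / Δ⌋₊ → ℤ) :
    observationLaw P X T Δ {x}
      = ∏ i, skellamMeasure (ϑ.toNNReal * Δ.toNNReal) {increments x i} := by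
  rw [← Measure.pi_singleton, ← observationLaw_map_increments hX,
    Measure.map_apply .of_discrete (measurableSet_singleton _), ← Set.image_singleton,
    increments_injective.preimage_image]

end Increments

section ObservedExperiment

variable {Ω : Type*} [MeasurableSpace Ω]

section LikelihoodRatio

variable {P P' : Measure Ω} [IsProbabilityMeasure P] [IsProbabilityMeasure P'] {ϑ ϑ' : ℝ}
  {X X' : ℝ≥0 → Ω → ℤ}

lemma observationLaw_eq_withDensity (hX : IsBernoulliCompoundPoisson ϑ X P)
    (hX' : IsBernoulliCompoundPoisson ϑ' X' P') (hϑ : 0 < ϑ) (T : ℝ) {Δ : ℝ} (hΔ : 0 < Δ) :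
    observationLaw P' X' T Δ = (observationLaw P X T Δ).withDensity fun x =>
      ∏ i, ENNReal.ofReal
        (skellamRatio (ϑ.toNNReal * Δ.toNNReal) (ϑ'.toNNReal * Δ.toNNReal) (increments x i)) := by
  have hl : 0 < ϑ.toNNReal * Δ.toNNReal :=
    mul_pos (Real.toNNReal_pos.2 hϑ) (Real.toNNReal_pos.2 hΔ)
  refine Measure.ext_of_singleton fun x => ?_
  rw [withDensity_apply _ (measurableSet_singleton x), lintegral_singleton,
    observationLaw_singleton hX, observationLaw_singleton hX', ← Finset.prod_mul_distrib]
  refine Finset.prod_congr rfl fun i _ => ?_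
  rw [skellamMeasure_singleton, skellamMeasure_singleton,
    ← ENNReal.ofReal_mul (skellamRatio_nonneg _ _ _), mul_comm (skellamRatio _ _ _),
    skellamProb_mul_skellamRatio hl]

lemma rnDeriv_observationLaw (hX : IsBernoulliCompoundPoisson ϑ X P)
    (hX' : IsBernoulliCompoundPoisson ϑ' X' P') (hϑ : 0 < ϑ) (hϑ' : 0 < ϑ') (T : ℝ) {Δ : ℝ}
    (hΔ : 0 < Δ) :
    ∀ᵐ x ∂(observationLaw P X T Δ),
      ((observationLaw P' X' T Δ).rnDeriv (observationLaw P X T Δ) x).toReal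
        = Real.exp (∑ i, Real.log (skellamRatio (ϑ.toNNReal * Δ.toNNReal)
            (ϑ'.toNNReal * Δ.toNNReal) (increments x i))) := by
  have hpos {θ : ℝ} (hθ : 0 < θ) : 0 < θ.toNNReal * Δ.toNNReal :=
    mul_pos (Real.toNNReal_pos.2 hθ) (Real.toNNReal_pos.2 hΔ)
  have : IsProbabilityMeasure (observationLaw P X T Δ) :=
    Measure.isProbabilityMeasure_map
      (measurable_pi_lambda _ fun _ => hX.measurable _).aemeasurable
  rw [observationLaw_eq_withDensity hX hX' hϑ T hΔ]
  filter_upwards [Measure.rnDeriv_withDensity (observationLaw P X T Δ)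
    (Measurable.of_discrete (f := fun x : Fin ⌊T / Δ⌋₊ → ℤ => ∏ i, ENNReal.ofReal
      (skellamRatio (ϑ.toNNReal * Δ.toNNReal) (ϑ'.toNNReal * Δ.toNNReal) (increments x i))))]
    with x hx
  rw [hx, ENNReal.toReal_prod, Real.exp_sum]
  refine Finset.prod_congr rfl fun i _ => ?_
  rw [ENNReal.toReal_ofReal (skellamRatio_nonneg _ _ _),
    Real.exp_log (skellamRatio_pos (hpos hϑ) (hpos hϑ') _)]

end LikelihoodRatio

section LocalParameter

variable {Δ I : ℝ → ℝ} {ϑ : ℝ}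

lemma tendsto_atTop_of_isEquivalent_macroInformation (hϑ : 0 < ϑ)
    (hn_top : Tendsto (fun T => T / Δ T) atTop atTop) (hequiv : I ~[atTop] macroInformation Δ ϑ) :
    Tendsto I atTop atTop :=
  hequiv.symm.tendsto_atTop (hn_top.atTop_div_const (by positivity : 0 < 2 * ϑ ^ 2))

lemma tendsto_sqrt_floor_mul_local_parameter (hϑ : 0 < ϑ)
    (hn_top : Tendsto (fun T => T / Δ T) atTop atTop)
    (hequiv : I ~[atTop] macroInformation Δ ϑ) (v : ℝ) :
    Tendsto (fun T => √(⌊T / Δ T⌋₊ : ℝ) * (v / (ϑ * √(I T)))) atTop (𝓝 (v * √2)) := by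
  have hI : ∀ᶠ T in atTop, 0 < I T :=
    (tendsto_atTop_of_isEquivalent_macroInformation hϑ hn_top hequiv).eventually_gt_atTop 0
  have hinfo : Tendsto (fun T => macroInformation Δ ϑ T / I T) atTop (𝓝 1) :=
    (isEquivalent_iff_tendsto_one (hI.mono fun _ => ne_of_gt)).1 hequiv.symm
  have hfloor : Tendsto (fun T => (⌊T / Δ T⌋₊ : ℝ) / (T / Δ T)) atTop (𝓝 1) :=
    tendsto_nat_floor_div_atTop.comp hn_top
  have hlim := (((hfloor.mul hinfo).const_mul 2).sqrt).const_mul v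
  simp only [mul_one] at hlim
  refine hlim.congr' ?_
  filter_upwards [hI, hn_top.eventually_gt_atTop 0] with T hIT hq
  have hratio : 2 * ((⌊T / Δ T⌋₊ : ℝ) / (T / Δ T) * (macroInformation Δ ϑ T / I T))
      = (⌊T / Δ T⌋₊ : ℝ) / (ϑ ^ 2 * I T) := by
    rw [macroInformation, ← div_eq_mul_inv]
    generalize T / Δ T = q at *
    field_simp
  rw [hratio, Real.sqrt_div (Nat.cast_nonneg _), Real.sqrt_mul (by positivity), Real.sqrt_sq hϑ.le]
  ring

lemma tendsto_sqrt_floor_mul_intensity_ratio_sub_one (hϑ : 0 < ϑ)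
    (hΔ_top : Tendsto Δ atTop atTop) (hn_top : Tendsto (fun T => T / Δ T) atTop atTop)
    (hequiv : I ~[atTop] macroInformation Δ ϑ) (v : ℝ) :
    Tendsto (fun T => √(⌊T / Δ T⌋₊ : ℝ) * ((((ϑ + v / √(I T)).toNNReal * (Δ T).toNNReal : ℝ≥0) : ℝ)
      / (ϑ.toNNReal * (Δ T).toNNReal : ℝ≥0) - 1)) atTop (𝓝 (v * √2)) := by
  have hsqrt : Tendsto (fun T => √(I T)) atTop atTop :=
    Real.tendsto_sqrt_atTop.comp
      (tendsto_atTop_of_isEquivalent_macroInformation hϑ hn_top hequiv)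
  have hlocal : Tendsto (fun T => ϑ + v / √(I T)) atTop (𝓝 ϑ) := by
    simpa only [add_zero] using (hsqrt.const_div_atTop v).const_add ϑ
  refine (tendsto_sqrt_floor_mul_local_parameter hϑ hn_top hequiv v).congr' ?_
  filter_upwards [hlocal.eventually_const_lt hϑ, hΔ_top.eventually_gt_atTop 0] with T hpos hΔT
  rw [NNReal.coe_mul, NNReal.coe_mul, mul_div_mul_right _ _ (by simpa using hΔT),
    Real.coe_toNNReal _ hpos.le, Real.coe_toNNReal _ hϑ.le, add_div, div_self hϑ.ne',
    add_sub_cancel_left, div_div, mul_comm ϑ]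

end LocalParameter

theorem isLANAt_of_isEquivalent_macroInformation {Θ : Set ℝ} (hΘ_pos : Θ ⊆ Set.Ioi 0)
    {P : ℝ → Measure Ω} [∀ ϑ, IsProbabilityMeasure (P ϑ)] {X : ℝ → ℝ≥0 → Ω → ℤ}
    (hX : ∀ ϑ ∈ Θ, IsBernoulliCompoundPoisson ϑ (X ϑ) (P ϑ))
    {Δ : ℝ → ℝ} (hΔ : ∀ T > 0, 0 < Δ T) (hΔ_top : Tendsto Δ atTop atTop)
    (hn_top : Tendsto (fun T => T / Δ T) atTop atTop)
    {ϑ : ℝ} (hϑ : ϑ ∈ Θ) {I : ℝ → ℝ} (hI : ∀ T > 0, 0 < I T)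
    (hequiv : I ~[atTop] macroInformation Δ ϑ) :
    IsLANAt (fun T ϑ' => observationLaw (P ϑ') (X ϑ') T (Δ T)) Θ I ϑ := by
  have hϑ0 : 0 < ϑ := hΘ_pos hϑ
  let l (θ T : ℝ) : ℝ≥0 := θ.toNNReal * (Δ T).toNNReal
  have hn : Tendsto (fun T => ⌊T / Δ T⌋₊) atTop atTop := tendsto_nat_floor_atTop.comp hn_top
  have hl : Tendsto (l ϑ) atTop atTop :=
    (tendsto_real_toNNReal_atTop.comp hΔ_top).const_mul_atTop (Real.toNNReal_pos.2 hϑ0)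
  have hζ := isAsymptoticallyStandard_squareScore hl
  have hpi (T : ℝ) : Measure.pi (fun _ : Fin ⌊T / Δ T⌋₊ => skellamMeasure (l ϑ T))
      = (observationLaw (P ϑ) (X ϑ) T (Δ T)).map increments :=
    (observationLaw_map_increments (hX ϑ hϑ) T (Δ T)).symm
  let ξ (T : ℝ) (x : Fin ⌊T / Δ T⌋₊ → ℤ) : ℝ :=
    normalizedSum ⌊T / Δ T⌋₊ (squareScore (l ϑ T)) (increments x)
  let r (v T : ℝ) (x : Fin ⌊T / Δ T⌋₊ → ℤ) : ℝ :=
    ∑ i, Real.log (skellamRatio (l ϑ T) (l (ϑ + v / √(I T)) T) (increments x i))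
      - v * ξ T x + v ^ 2 / 2
  refine ⟨hI, ξ, fun T => .of_discrete, fun g => ?_,
    fun v => ⟨r v, fun T => .of_discrete, fun T hT hv => ?_, fun δ hδ => ?_⟩⟩
  · simpa only [hpi, integral_map Measurable.of_discrete.aemeasurable
      Measurable.of_discrete.aestronglyMeasurable] using hζ.tendsto_integral_normalizedSum hn g
  · filter_upwards [rnDeriv_observationLaw (hX ϑ hϑ) (hX _ hv) hϑ0 (hΘ_pos hv) T (hΔ T hT)]
      with x hx
    rw [hx]
    congr 1
    ring
  · refine Tendsto.mono_left ?_ inf_le_left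
    have hlog := (isLocalAlternative_skellamRatio hn hl
      (tendsto_sqrt_floor_mul_intensity_ratio_sub_one hϑ0 hΔ_top hn_top hequiv
        v)).tendstoZeroInProb_sum_log hζ hn δ hδ
    simp only [hpi] at hlog
    refine hlog.congr fun T => ?_
    exact Measure.map_apply .of_discrete (Set.to_countable _).measurableSet

end ObservedExperiment

theorem theorem3_general {Ω : Type*} [MeasurableSpace Ω]
    (Θ : Set ℝ) (hΘ_pos : Θ ⊆ Set.Ioi 0)
    (P : ℝ → Measure Ω) [∀ ϑ, IsProbabilityMeasure (P ϑ)] (X : ℝ → ℝ≥0 → Ω → ℤ)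
    (hX : ∀ ϑ ∈ Θ, IsBernoulliCompoundPoisson ϑ (X ϑ) (P ϑ))
    (Δ : ℝ → ℝ) (hΔ : ∀ T > 0, 0 < Δ T) (hΔ_top : Tendsto Δ atTop atTop)
    (hn_top : Tendsto (fun T => T / Δ T) atTop atTop) (ϑ : ℝ) (hϑ : ϑ ∈ Θ) :
    IsLANAt (fun T ϑ' => observationLaw (P ϑ') (X ϑ') T (Δ T)) Θ (macroInformation Δ ϑ) ϑ ∧
    ∀ I : ℝ → ℝ, (∀ T > 0, 0 < I T) → I ~[atTop] macroInformation Δ ϑ →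
      IsLANAt (fun T ϑ' => observationLaw (P ϑ') (X ϑ') T (Δ T)) Θ I ϑ := by
  have hLAN {I : ℝ → ℝ} (hI : ∀ T > 0, 0 < I T) (hequiv : I ~[atTop] macroInformation Δ ϑ) :=
    isLANAt_of_isEquivalent_macroInformation hΘ_pos hX hΔ hΔ_top hn_top hϑ hI hequiv
  refine ⟨hLAN (fun T hT => ?_) .refl, fun I hI hequiv => hLAN hI hequiv⟩
  have hϑ0 : 0 < ϑ := hΘ_pos hϑ
  exact div_pos (mul_pos hT (inv_pos.2 (hΔ T hT))) (by positivity)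

theorem theorem3 {Ω : Type*} [MeasurableSpace Ω]
    (Θ : Set ℝ) (hΘ_pos : Θ ⊆ Set.Ioi 0) (_hΘ_int : (interior Θ).Nonempty)
    (P : ℝ → Measure Ω) [∀ ϑ, IsProbabilityMeasure (P ϑ)] (X : ℝ → ℝ≥0 → Ω → ℤ)
    (hX : ∀ ϑ ∈ Θ, IsBernoulliCompoundPoisson ϑ (X ϑ) (P ϑ))
    (Δ : ℝ → ℝ) (hΔ : ∀ T > 0, 0 < Δ T ∧ Δ T ≤ T)
    (hΔ_top : Tendsto Δ atTop atTop)
    (hn_top : Tendsto (fun T => T / Δ T) atTop atTop)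
    (hrate : (fun T => T / Δ T ^ (1 + 1 / 4 : ℝ)) =o[atTop]
      fun T => Real.log (T / Δ T) ^ (-(1 / 4) : ℝ))
    (ϑ : ℝ) (hϑ : ϑ ∈ Θ) :
    IsLANAt (fun T ϑ' => observationLaw (P ϑ') (X ϑ') T (Δ T)) Θ (macroInformation Δ ϑ) ϑ ∧
    ∀ I : ℝ → ℝ, (∀ T > 0, 0 < I T) → I ~[atTop] macroInformation Δ ϑ →
      IsLANAt (fun T ϑ' => observationLaw (P ϑ') (X ϑ') T (Δ T)) Θ I ϑ :=
  theorem3_general Θ hΘ_pos P X hX Δ (fun T hT => (hΔ T hT).1) hΔ_top hn_top ϑ hϑ
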